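/- Let $d\ge 0$ and $M\ge 2$ be integers. For $m=1,\dots,M$ let $S_m:\mathbb R^d\to\mathbb R^d$ be a similarity with ratio $r_m\in(0,1)$, i.e. $|S_m(x)-S_m(y)|=r_m|x-y|$ for all $x,y$, and let $p_1,\dots,p_M>0$ with $\sum_m p_m=1$. Let $K$ be the self-similar set of this list, i.e. the unique nonempty compact $K\subset\mathbb R^d$ with $K=\bigcup_m S_m(K)$, and let $\pi$ be the self-similar measure, i.e. the unique Borel probability measure on $\mathbb R^d$ with $\pi=\sum_m p_m\,\pi\circ S_m^{-1}$; its support is $K$. Assume the Open Set Condition: there is a nonempty bounded open set $U\subset\mathbb R^d$ with $S_m(U)\subset U$ for all $m$ and $S_m(U)\cap S_l(U)=\varnothing$ for all $l\ne m$. Put $$s_{\min}=\min_m\frac{\log p_m}{\log r_m},\qquad s_{\max}=\max_m\frac{\log p_m}{\log r_m}.$$ For $E\subset K$, $r>0$ and $q\in\mathbb R$ let $$\mathbf N_\pi^q(E,r)=\inf\sum_i\pi\big(B(x_i,r)\big)^q,$$ the infimum being taken over all countable covers $(B(x_i,r))_i$ of $E$ by open balls of radius $r$ with centres $x_i\in K$,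 and let $$\underline{\dim}_{\pi,B}^q(E)=\liminf_{r\to0^+}\frac{\log\mathbf N_\pi^q(E,r)}{-\log r}\in[-\infty,+\infty].$$ Let $\mathcal P(K)$ be the space of Borel probability measures on $K$ with the weak topology. For $\mu\in\mathcal P(K)$, the small and big lower multifractal box dimensions of $\mu$ of order $q$ with respect to $\pi$ are $$\underline{\dim}^{q}_{*,\pi,B}(\mu)=\inf_{\mu(E)>0}\underline{\dim}_{\pi,B}^q(E),\qquad \underline{\dim}^{*,q}_{\pi,B}(\mu)=\lim_{\varepsilon\to0^+}\ \inf_{\mu(E)>1-\varepsilon}\underline{\dim}_{\pi,B}^q(E),$$ where $E$ runs through the Borel subsets of $K$. Then a typical $\mu\in\mathcal P(K)$ satisfies $$\underline{\dim}^{q}_{*,\pi,B}(\mu)=\underline{\dim}^{*,q}_{\pi,B}(\mu)=\begin{cases}-s_{\max}\,q&\text{for every } q\ge0,\\ -s_{\min}\,q&\text{for every } q\le0,\end{cases}$$ that is, there is a dense $G_\delta$ subset $\mathcal R$ of $\mathcal P(K)$ such that for every $\mu\in\mathcal R$ these equalities hold for all $q$ simultaneously. -/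

import Mathlib

open MeasureTheory Filter Topology Set
open scoped ENNReal

noncomputable section

/-- `N_π^q(E, r)`: the infimum of `∑ π(B(x,r))^q` over all countable covers of `E` by open balls
`B(x,r)` of radius `r` with centres `x` in `K` (here `K` is the support of `π` and `E ⊆ K`). -/
def coverSum {X : Type*} [PseudoMetricSpace X] [MeasurableSpace X]
    (π : Measure X) (K : Set X) (q : ℝ) (E : Set X) (r : ℝ) : ℝ≥0∞ :=
  ⨅ (A : Set X) (_ : A.Countable) (_ : A ⊆ K) (_ : E ⊆ ⋃ x ∈ A, Metric.ball x r),
    ∑' x : A, (π (Metric.ball (x : X) r)) ^ q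

/-- The lower covering multifractal box dimension of order `q` of a set `E ⊆ K` with respect
to `π`, as an extended real number: `liminf_{r → 0+} log N_π^q(E, r) / (-log r)`. -/
def lowerMultifractalBoxDim {X : Type*} [PseudoMetricSpace X] [MeasurableSpace X]
    (π : Measure X) (K : Set X) (q : ℝ) (E : Set X) : EReal :=
  liminf (fun r : ℝ => ENNReal.log (coverSum π K q E r) / ((-Real.log r : ℝ) : EReal)) (𝓝[>] 0)

/-- The small lower multifractal box dimension of order `q` of a probability measure `μ` on `K`:
the infimum of the lower dimensions of the Borel sets `E ⊆ K` with `μ(E) > 0`. -/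
def smallLowerDim {X : Type*} [PseudoMetricSpace X] [MeasurableSpace X]
    (π : Measure X) (K : Set X) (q : ℝ) (μ : ProbabilityMeasure K) : EReal :=
  ⨅ (E : Set K) (_ : MeasurableSet E) (_ : 0 < (μ : Measure K).real E),
    lowerMultifractalBoxDim π K q (Subtype.val '' E)

/-- The infimum of the lower dimensions of the Borel sets `E ⊆ K` with `μ(E) > 1 - ε`. -/
def lowerDimUpTo {X : Type*} [PseudoMetricSpace X] [MeasurableSpace X]
    (π : Measure X) (K : Set X) (q : ℝ) (μ : ProbabilityMeasure K) (ε : ℝ) : EReal :=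
  ⨅ (E : Set K) (_ : MeasurableSet E) (_ : 1 - ε < (μ : Measure K).real E),
    lowerMultifractalBoxDim π K q (Subtype.val '' E)

/-- The big lower multifractal box dimension of order `q` of `μ`: the limit of
`lowerDimUpTo π K q μ ε` as `ε → 0+`. The quantity is monotone in `ε`, so that this limit is
a supremum; see `tendsto_lowerDimUpTo`. -/
def bigLowerDim {X : Type*} [PseudoMetricSpace X] [MeasurableSpace X]
    (π : Measure X) (K : Set X) (q : ℝ) (μ : ProbabilityMeasure K) : EReal :=
  ⨆ (ε : ℝ) (_ : 0 < ε), lowerDimUpTo π K q μ ε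

theorem lowerDimUpTo_antitone {X : Type*} [PseudoMetricSpace X] [MeasurableSpace X]
    (π : Measure X) (K : Set X) (q : ℝ) (μ : ProbabilityMeasure K) :
    Antitone (lowerDimUpTo π K q μ) := by
  intro a b hab
  refine le_iInf fun E => le_iInf fun hE => le_iInf fun h => ?_
  exact iInf_le_of_le E (iInf_le_of_le hE (iInf_le_of_le (by linarith) le_rfl))

theorem tendsto_lowerDimUpTo {X : Type*} [PseudoMetricSpace X] [MeasurableSpace X]
    (π : Measure X) (K : Set X) (q : ℝ) (μ : ProbabilityMeasure K) :
    Tendsto (lowerDimUpTo π K q μ) (𝓝[>] 0) (𝓝 (bigLowerDim π K q μ)) := by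
  have h := (lowerDimUpTo_antitone π K q μ).tendsto_nhdsGT 0
  rwa [sSup_image] at h

/-- `S m` is a similarity of ratio `r m ∈ (0,1)` for every `m`. -/
def IsSimilaritySystem {X ι : Type*} [PseudoMetricSpace X] (S : ι → X → X) (r : ι → ℝ) : Prop :=
  ∀ m, 0 < r m ∧ r m < 1 ∧ ∀ x y, dist (S m x) (S m y) = r m * dist x y

/-- `K` is the self-similar set of the list `S`: the nonempty compact set with
`K = ⋃ m, S m (K)`. -/
def IsSelfSimilarSet {X ι : Type*} [TopologicalSpace X] (S : ι → X → X) (K : Set X) : Prop :=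
  IsCompact K ∧ K.Nonempty ∧ K = ⋃ m, S m '' K

/-- `π` is the self-similar measure of the list `(S, p)`: the Borel probability measure on the
whole space with `π = ∑ m, p m • π ∘ (S m)⁻¹`. -/
def IsSelfSimilarMeasure {X ι : Type*} [Fintype ι] [MeasurableSpace X] (S : ι → X → X)
    (p : ι → ℝ) (π : Measure X) : Prop :=
  IsProbabilityMeasure π ∧ π = ∑ m, ENNReal.ofReal (p m) • π.map (S m)

/-- The Open Set Condition. -/
def OpenSetCondition {X ι : Type*} [PseudoMetricSpace X] (S : ι → X → X) : Prop :=
  ∃ U : Set X, IsOpen U ∧ U.Nonempty ∧ Bornology.IsBounded U ∧ (∀ m, S m '' U ⊆ U) ∧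
    ∀ l m, l ≠ m → Disjoint (S m '' U) (S l '' U)

/-- A typical point of `Y` has the property `P`: it holds on a dense `G_δ` subset. -/
def Typically {Y : Type*} [TopologicalSpace Y] (P : Y → Prop) : Prop :=
  ∃ R : Set Y, IsGδ R ∧ Dense R ∧ ∀ y ∈ R, P y

end

/-!
The typical values depend on `π` only through four power bounds for the mass of balls centred in `K`
(`typically_lowerDim_eq`): every ball of radius `t` has mass between constant multiples of
`t ^ smax` and `t ^ smin`, and each of the two exponents is attained, near every point of `K` and at
every small scale, by some ball.

The uniform bounds give the lower bounds for the dimensions: a cover of a nonempty set contains at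
least one ball, whose contribution `π (ball x t) ^ q` is at least about `t ^ (smax * q)` for `q ≥ 0`
and `t ^ (smin * q)` for `q ≤ 0`. For the upper bounds, the measures that are concentrated on few
balls of extremal mass, at some small scale, form a dense open subset of the space of probability
measures (`isOpen_isConcentrated`, `dense_isConcentrated`). That space is compact, so Baire's theorem
provides a dense `G_δ` set of measures with this property at every precision, and a tail intersection
of the corresponding unions of balls is a set of mass close to `1` whose dimension has the required
upper bound (`bigLowerDim_le`). The sets of measures do not depend on `q`.

The lower mass bound and the existence of heavy balls hold for every self-similar measure
(`IsSelfSimilarMeasure.exists_le_measure_ball`, `IsSelfSimilarMeasure.exists_thick_ball`). The other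
two bounds use the open set condition. The upper mass bound compares the mass of a ball with the
volume of its intersection with `U`, scale by scale (`IsSelfSimilarMeasure.exists_measure_ball_le`).
The existence of light balls needs a place in `K` such that, in every cylinder, the ball at the
corresponding place is approached by no other cylinder
(`IsSelfSimilarMeasure.exists_measure_ball_wordMap_le`); as in Schief's proof that the open set
condition implies the strong one, it is found by maximizing the number of separated cylinders of
comparable size close to a point. In cylinders of words that end in a long constant string of a
letter `m` with `p m = r m ^ smax`, balls at these places are light
(`IsSimilaritySystem.exists_thin_ball`).
-/

/-! ### Typical measures are concentrated near good points -/

theorem Typically.and {Y : Type*} [TopologicalSpace Y] [BaireSpace Y] {P Q : Y → Prop}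
    (hP : Typically P) (hQ : Typically Q) : Typically fun y => P y ∧ Q y := by
  obtain ⟨R, hR, hRd, hRP⟩ := hP
  obtain ⟨T, hT, hTd, hTQ⟩ := hQ
  exact ⟨R ∩ T, hR.inter hT, hRd.inter_of_Gδ hR hT hTd, fun y hy => ⟨hRP y hy.1, hTQ y hy.2⟩⟩

theorem isOpen_setOf_lt_measure {Y : Type*} [MetricSpace Y] [MeasurableSpace Y] [BorelSpace Y]
    {G : Set Y} (hG : IsOpen G) (c : ℝ≥0∞) :
    IsOpen {μ : ProbabilityMeasure Y | c < (μ : Measure Y) G} := by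
  rw [isOpen_iff_mem_nhds]
  intro μ hμ
  have h := ProbabilityMeasure.le_liminf_measure_open_of_tendsto (tendsto_id (x := 𝓝 μ)) hG
  exact eventually_lt_of_lt_liminf (lt_of_lt_of_le hμ h)

/-- Pointwise convergence to the identity implies weak convergence of the image measures. -/
theorem tendsto_map_of_tendsto {Y : Type*} [MetricSpace Y] [MeasurableSpace Y] [BorelSpace Y]
    (μ : ProbabilityMeasure Y) {f : ℕ → Y → Y} (hf : ∀ n, Measurable (f n))
    (h : ∀ x, Tendsto (fun n => f n x) atTop (𝓝 x)) :
    Tendsto (fun n => μ.map (hf n).aemeasurable) atTop (𝓝 μ) := by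
  rw [ProbabilityMeasure.tendsto_iff_forall_integral_tendsto]
  intro g
  have : ∀ n, ∫ y, g y ∂(μ.map (hf n).aemeasurable : Measure Y) =
      ∫ x, g (f n x) ∂(μ : Measure Y) := by
    intro n
    rw [ProbabilityMeasure.toMeasure_map]
    exact integral_map (hf n).aemeasurable g.continuous.measurable.aestronglyMeasurable
  simp only [this]
  refine tendsto_integral_of_dominated_convergence (fun _ => ‖g‖) (fun n => ?_)
    (integrable_const _) (fun n => ae_of_all _ fun x => g.norm_coe_le_norm _)
    (ae_of_all _ fun x => (g.continuous.tendsto x).comp (h x))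
  exact (g.continuous.measurable.comp (hf n)).aestronglyMeasurable

/-- `μ` gives mass more than `1 - 2⁻⁽ⁿ⁺¹⁾` to a union of at most `t ^ (-1 / (n + 1))` balls of one
radius `t < 1 / (n + 1)` whose centres satisfy `G n t`. The relation `G n t y` is read as
"`y` is good at scale `t`, to precision `n`". -/
def IsConcentrated {Y : Type*} [MetricSpace Y] [MeasurableSpace Y] (G : ℕ → ℝ → Y → Prop)
    (n : ℕ) (μ : ProbabilityMeasure Y) : Prop :=
  ∃ (F : Finset Y) (t : ℝ), 0 < t ∧ t < 1 / (n + 1) ∧ (∀ y ∈ F, G n t y) ∧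
    (F.card : ℝ) ≤ t ^ (-(1 / (n + 1) : ℝ)) ∧
    ENNReal.ofReal (1 - (1 / 2) ^ (n + 1)) < (μ : Measure Y) (⋃ y ∈ F, Metric.ball y t)

theorem isOpen_isConcentrated {Y : Type*} [MetricSpace Y] [MeasurableSpace Y] [BorelSpace Y]
    (G : ℕ → ℝ → Y → Prop) (n : ℕ) : IsOpen {μ | IsConcentrated G n μ} := by
  simp only [IsConcentrated, ofPred_exists, ofPred_and]
  refine isOpen_iUnion fun F => isOpen_iUnion fun t => ?_
  refine isOpen_const.inter (isOpen_const.inter (isOpen_const.inter (isOpen_const.inter ?_)))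
  exact isOpen_setOf_lt_measure (isOpen_biUnion fun _ _ => Metric.isOpen_ball) _

/-- If good points are dense at every small scale, then every measure is a limit of measures carried
by finitely many points that are good at a common scale. These are the images of the measure under
the map to the nearest among finitely many points of a dense sequence, each moved to a good point
nearby. -/
theorem dense_isConcentrated {Y : Type*} [MetricSpace Y] [CompactSpace Y] [MeasurableSpace Y]
    [BorelSpace Y] (G : ℕ → ℝ → Y → Prop) (n : ℕ)
    (hG : ∀ x : Y, ∀ η > 0, ∀ᶠ t in 𝓝[>] (0 : ℝ), ∃ y, dist y x < η ∧ G n t y) :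
    Dense {μ | IsConcentrated G n μ} := by
  intro μ
  have : Nonempty Y := μ.nonempty
  let e : ℕ → Y := TopologicalSpace.denseSeq Y
  have hn : (0 : ℝ) < 1 / (n + 1) := by positivity
  -- A scale `t` so small that it has good points near `e 0, …, e N` and that `N + 1` balls are few.
  have key : ∀ N : ℕ, ∃ t : ℝ, 0 < t ∧ t < 1 / (n + 1) ∧
      ((N + 1 : ℕ) : ℝ) ≤ t ^ (-(1 / (n + 1) : ℝ)) ∧
      ∀ k ∈ Finset.range (N + 1), ∃ y, dist y (e k) < 1 / ((N : ℝ) + 1) ∧ G n t y := by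
    intro N
    have h1 : ∀ᶠ t in 𝓝[>] (0 : ℝ), 0 < t := eventually_mem_nhdsWithin
    have h2 : ∀ᶠ t in 𝓝[>] (0 : ℝ), t < 1 / ((n : ℝ) + 1) :=
      (eventually_lt_nhds hn).filter_mono nhdsWithin_le_nhds
    have h3 : ∀ᶠ t in 𝓝[>] (0 : ℝ), ((N + 1 : ℕ) : ℝ) ≤ t ^ (-(1 / (n + 1) : ℝ)) :=
      (tendsto_rpow_neg_nhdsGT_zero (neg_lt_zero.2 hn)).eventually_ge_atTop _
    have h4 : ∀ᶠ t in 𝓝[>] (0 : ℝ), ∀ k ∈ Finset.range (N + 1),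
        ∃ y, dist y (e k) < 1 / ((N : ℝ) + 1) ∧ G n t y :=
      (Finset.eventually_all _).2 fun k _ => hG (e k) _ (by positivity)
    obtain ⟨t, a, b, c, d⟩ := (h1.and (h2.and (h3.and h4))).exists
    exact ⟨t, a, b, c, d⟩
  choose t ht0 ht1 htc hy using key
  choose! y hyd hyG using hy
  let f : ℕ → SimpleFunc Y Y := fun N => (SimpleFunc.nearestPtInd e N).map (y N)
  have hfd : ∀ N x, dist (f N x) (SimpleFunc.nearestPt e N x) < 1 / ((N : ℝ) + 1) := fun N x =>
    hyd N _ (Finset.mem_range_succ_iff.2 (SimpleFunc.nearestPtInd_le e N x))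
  have hlim : ∀ x, Tendsto (fun N => f N x) atTop (𝓝 x) := fun x => by
    have h := SimpleFunc.tendsto_nearestPt (e := e) (x := x)
      ((TopologicalSpace.denseRange_denseSeq Y).closure_range ▸ mem_univ x)
    refine (tendsto_iff_of_dist ?_).2 h
    exact squeeze_zero (fun _ => dist_nonneg) (fun N => (hfd N x).le)
      tendsto_one_div_add_atTop_nhds_zero_nat
  refine mem_closure_of_tendsto
    (tendsto_map_of_tendsto μ (f := fun N => f N) (fun N => (f N).measurable) hlim)
    (Eventually.of_forall fun N => ?_)
  classical
  refine ⟨(Finset.range (N + 1)).image (y N), t N, ht0 N, ht1 N, ?_, ?_, ?_⟩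
  · intro z hz
    obtain ⟨k, hk, rfl⟩ := Finset.mem_image.1 hz
    exact hyG N k hk
  · refine le_trans ?_ (htc N)
    exact_mod_cast Finset.card_image_le.trans (Finset.card_range _).le
  · have hm : MeasurableSet (⋃ z ∈ (Finset.range (N + 1)).image (y N), Metric.ball z (t N)) :=
      (isOpen_biUnion fun _ _ => Metric.isOpen_ball).measurableSet
    have : (f N) ⁻¹' (⋃ z ∈ (Finset.range (N + 1)).image (y N), Metric.ball z (t N)) = univ := by
      refine eq_univ_of_forall fun x => mem_iUnion₂.2 ⟨f N x, ?_, Metric.mem_ball_self (ht0 N)⟩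
      exact Finset.mem_image_of_mem _
        (Finset.mem_range_succ_iff.2 (SimpleFunc.nearestPtInd_le e N x))
    rw [ProbabilityMeasure.toMeasure_map, Measure.map_apply (f N).measurable hm, this, measure_univ]
    rw [ENNReal.ofReal_lt_one]
    have : (0 : ℝ) < (1 / 2) ^ (n + 1) := by positivity
    linarith

theorem typically_isConcentrated {Y : Type*} [MetricSpace Y] [CompactSpace Y] [MeasurableSpace Y]
    [BorelSpace Y] (G : ℕ → ℝ → Y → Prop)
    (hG : ∀ n, ∀ x : Y, ∀ η > 0, ∀ᶠ t in 𝓝[>] (0 : ℝ), ∃ y, dist y x < η ∧ G n t y) :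
    Typically fun μ : ProbabilityMeasure Y => ∀ n, IsConcentrated G n μ :=
  ⟨⋂ n, {μ | IsConcentrated G n μ}, IsGδ.iInter_of_isOpen fun n => isOpen_isConcentrated G n,
    dense_iInter_of_isOpen (fun n => isOpen_isConcentrated G n)
      fun n => dense_isConcentrated G n (hG n), fun _ hμ n => mem_iInter.1 hμ n⟩

/-! ### Bounds for multifractal box dimensions -/

theorem log_div_neg_log {t : ℝ} (ht : 0 < t) (ht1 : t < 1) (b : ℝ) :
    ENNReal.log (ENNReal.ofReal (t ^ b)) / ((-Real.log t : ℝ) : EReal) = ((-b : ℝ) : EReal) := by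
  have hl := (Real.log_neg ht ht1).ne
  rw [ENNReal.log_ofReal_of_pos (Real.rpow_pos_of_pos ht b), Real.log_rpow ht, ← EReal.coe_div]
  congr 1
  field_simp

theorem le_lowerMultifractalBoxDim {X : Type*} [PseudoMetricSpace X] [MeasurableSpace X]
    {π : Measure X} {K E : Set X} {q a : ℝ}
    (h : ∀ δ > 0, ∀ᶠ t in 𝓝[>] (0 : ℝ), ENNReal.ofReal (t ^ (a + δ)) ≤ coverSum π K q E t) :
    ((-a : ℝ) : EReal) ≤ lowerMultifractalBoxDim π K q E := by
  refine EReal.ge_of_forall_gt_iff_ge.1 fun z hz => ?_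
  have hz : z < -a := by exact_mod_cast hz
  refine le_liminf_of_le (by isBoundedDefault) ?_
  filter_upwards [h (-a - z) (by linarith), eventually_mem_nhdsWithin,
    (eventually_lt_nhds one_pos).filter_mono nhdsWithin_le_nhds] with t ht h0 h1
  have := EReal.div_le_div_right_of_nonneg (c := ((-Real.log t : ℝ) : EReal))
    (by exact_mod_cast (neg_pos.2 (Real.log_neg h0 h1)).le) (ENNReal.log_monotone ht)
  rw [log_div_neg_log h0 h1] at this
  refine le_trans (le_of_eq ?_) this
  congr 1; ring

theorem lowerMultifractalBoxDim_le {X : Type*} [PseudoMetricSpace X] [MeasurableSpace X]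
    {π : Measure X} {K E : Set X} {q a : ℝ}
    (h : ∀ δ > 0, ∃ᶠ t in 𝓝[>] (0 : ℝ), coverSum π K q E t ≤ ENNReal.ofReal (t ^ (a - δ))) :
    lowerMultifractalBoxDim π K q E ≤ ((-a : ℝ) : EReal) := by
  refine EReal.le_of_forall_lt_iff_le.1 fun z hz => ?_
  have hz : -a < z := by exact_mod_cast hz
  refine liminf_le_of_frequently_le ?_ (by isBoundedDefault)
  refine ((h (a + z) (by linarith)).and_eventually (eventually_mem_nhdsWithin.and
    ((eventually_lt_nhds one_pos).filter_mono nhdsWithin_le_nhds))).mono ?_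
  rintro t ⟨ht, h0, h1⟩
  have := EReal.div_le_div_right_of_nonneg (c := ((-Real.log t : ℝ) : EReal))
    (by exact_mod_cast (neg_pos.2 (Real.log_neg h0 h1)).le) (ENNReal.log_monotone ht)
  rw [log_div_neg_log h0 h1] at this
  refine this.trans (le_of_eq ?_)
  congr 1; ring

/-- The small dimension is the term `ε = 1` of the supremum that defines the big dimension. -/
theorem smallLowerDim_le_bigLowerDim {X : Type*} [PseudoMetricSpace X] [MeasurableSpace X]
    (π : Measure X) (K : Set X) (q : ℝ) (μ : ProbabilityMeasure K) :
    smallLowerDim π K q μ ≤ bigLowerDim π K q μ := by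
  refine le_trans (le_of_eq ?_) (le_iSup₂ (f := fun (ε : ℝ) (_ : 0 < ε) => lowerDimUpTo π K q μ ε)
    1 one_pos)
  simp [smallLowerDim, lowerDimUpTo]

theorem coverSum_le_sum {X : Type*} [PseudoMetricSpace X] [MeasurableSpace X]
    (π : Measure X) {K : Set X} (q : ℝ) {E : Set X} {t : ℝ} (F : Finset K)
    (hE : E ⊆ ⋃ x ∈ F, Metric.ball (x : X) t) :
    coverSum π K q E t ≤ ∑ x ∈ F, π (Metric.ball (x : X) t) ^ q := by
  classical
  refine iInf_le_of_le (F.image (fun x : K => (x : X)) : Finset X) (iInf_le_of_le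
    (Finset.countable_toSet _) (iInf_le_of_le ?_ (iInf_le_of_le ?_ ?_)))
  · intro x hx
    obtain ⟨y, -, rfl⟩ := Finset.mem_image.1 hx
    exact y.2
  · simpa using hE
  · refine le_of_eq ?_
    rw [Finset.tsum_subtype' (F.image (fun x : K => (x : X)))
      (fun x => π (Metric.ball (x : X) t) ^ q)]
    exact Finset.sum_image fun x _ y _ h => Subtype.ext h

/-- A cover of a nonempty set has at least one ball, and one ball already gives the bound. -/
theorem le_coverSum {X : Type*} [PseudoMetricSpace X] [MeasurableSpace X]
    {π : Measure X} {K : Set X} {q : ℝ} {E : Set X} (hE : E.Nonempty) {t : ℝ} {b : ℝ≥0∞}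
    (h : ∀ x ∈ K, b ≤ π (Metric.ball x t) ^ q) : b ≤ coverSum π K q E t := by
  refine le_iInf fun A => le_iInf fun _ => le_iInf fun hAK => le_iInf fun hEA => ?_
  obtain ⟨z, hz⟩ := hE
  obtain ⟨x, hx, -⟩ := mem_iUnion₂.1 (hEA hz)
  exact (h x (hAK hx)).trans
    (ENNReal.le_tsum (f := fun x : A => π (Metric.ball (x : X) t) ^ q) ⟨x, hx⟩)

/-- The tail intersections of sets `E n` with `μ (E n) > 1 - 2⁻⁽ⁿ⁺¹⁾` have mass close to `1` and
inherit, along the sequence of scales `t n`, the covers of all the `E n`. -/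
theorem bigLowerDim_le {X : Type*} [PseudoMetricSpace X] [MeasurableSpace X]
    {π : Measure X} {K : Set X} {q a c : ℝ} {μ : ProbabilityMeasure K} (E : ℕ → Set K) (t : ℕ → ℝ)
    (hE : ∀ n, MeasurableSet (E n)) (ht0 : ∀ n, 0 < t n) (ht1 : ∀ n : ℕ, t n < 1 / (n + 1))
    (hμ : ∀ n, ENNReal.ofReal (1 - (1 / 2) ^ (n + 1)) < (μ : Measure K) (E n))
    (hs : ∀ n : ℕ, coverSum π K q (Subtype.val '' E n) (t n) ≤
      ENNReal.ofReal (t n ^ (a - c / (n + 1)))) :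
    bigLowerDim π K q μ ≤ ((-a : ℝ) : EReal) := by
  refine iSup₂_le fun ε hε => ?_
  obtain ⟨N, hN⟩ := exists_pow_lt_of_lt_one hε (by norm_num : (1 / 2 : ℝ) < 1)
  have hcompl : ∀ n, (μ : Measure K) (E n)ᶜ ≤ ENNReal.ofReal ((1 / 2) ^ (n + 1)) := fun n => by
    have h1 : (0 : ℝ) ≤ 1 - (1 / 2) ^ (n + 1) :=
      sub_nonneg.2 (pow_le_one₀ (by norm_num) (by norm_num))
    rw [prob_compl_eq_one_sub (hE n)]
    refine (tsub_le_tsub_left (hμ n).le 1).trans ?_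
    rw [← ENNReal.ofReal_one, ← ENNReal.ofReal_sub _ h1]
    apply le_of_eq; congr 1; ring
  have hm : MeasurableSet (⋂ n, E (n + N)) := MeasurableSet.iInter fun n => hE _
  have hbig : 1 - ε < (μ : Measure K).real (⋂ n, E (n + N)) := by
    have h1 : (μ : Measure K).real (⋂ n, E (n + N))ᶜ ≤ (1 / 2) ^ N := by
      refine ENNReal.toReal_le_of_le_ofReal (by positivity) ?_
      rw [compl_iInter]
      refine (measure_iUnion_le _).trans ((ENNReal.tsum_le_tsum fun n => hcompl (n + N)).trans ?_)
      have hsum : HasSum (fun n : ℕ => (1 / 2 : ℝ) ^ (n + N + 1)) ((1 / 2) ^ N) := by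
        have := (hasSum_geometric_two).mul_left ((1 / 2 : ℝ) ^ (N + 1))
        have e1 : (fun n : ℕ => (1 / 2 : ℝ) ^ (n + N + 1)) =
            fun n => (1 / 2) ^ (N + 1) * (1 / 2) ^ n := funext fun n => by ring
        have e2 : (1 / 2 : ℝ) ^ N = (1 / 2) ^ (N + 1) * 2 := by ring
        rwa [e1, e2]
      rw [← ENNReal.ofReal_tsum_of_nonneg (fun n => by positivity) hsum.summable, hsum.tsum_eq]
    rw [probReal_compl_eq_one_sub hm] at h1
    linarith
  refine iInf_le_of_le (⋂ n, E (n + N)) (iInf_le_of_le hm (iInf_le_of_le hbig ?_))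
  refine lowerMultifractalBoxDim_le fun δ hδ => ?_
  have hlim : Tendsto t atTop (𝓝[>] 0) := by
    refine tendsto_nhdsWithin_iff.2 ⟨?_, Eventually.of_forall ht0⟩
    exact squeeze_zero (fun n => (ht0 n).le) (fun n => (ht1 n).le)
      tendsto_one_div_add_atTop_nhds_zero_nat
  refine hlim.frequently (Eventually.frequently ?_)
  have hc : ∀ᶠ n : ℕ in atTop, c / ((n : ℝ) + 1) < δ := by
    have : Tendsto (fun n : ℕ => c * (1 / ((n : ℝ) + 1))) atTop (𝓝 (c * 0)) :=
      tendsto_one_div_add_atTop_nhds_zero_nat.const_mul c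
    rw [mul_zero] at this
    filter_upwards [this.eventually_lt_const hδ] with n hn
    rwa [mul_one_div] at hn
  filter_upwards [hc, eventually_ge_atTop N] with n hn hnN
  have hsub : Subtype.val '' (⋂ n, E (n + N)) ⊆ Subtype.val '' E n := by
    refine image_mono ((iInter_subset _ (n - N)).trans ?_)
    rw [Nat.sub_add_cancel hnN]
  have hmono : coverSum π K q (Subtype.val '' (⋂ n, E (n + N))) (t n) ≤
      coverSum π K q (Subtype.val '' E n) (t n) :=
    iInf_mono fun A => iInf_mono fun _ => iInf_mono fun _ =>
      iInf_mono' fun h => ⟨hsub.trans h, le_rfl⟩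
  refine (hmono.trans (hs n)).trans (ENNReal.ofReal_le_ofReal ?_)
  refine Real.rpow_le_rpow_of_exponent_ge (ht0 n) ?_ (by linarith)
  refine (ht1 n).le.trans ?_
  rw [div_le_one (by positivity)]
  linarith [(n.cast_nonneg : (0 : ℝ) ≤ n)]

theorem bigLowerDim_le_of_isConcentrated {X : Type*} [MetricSpace X] [MeasurableSpace X]
    [BorelSpace X] {π : Measure X} {K : Set X} {q a c : ℝ} {μ : ProbabilityMeasure K}
    {G : ℕ → ℝ → K → Prop} (hμ : ∀ n, IsConcentrated G n μ)
    (hG : ∀ (n : ℕ) (t : ℝ) (y : K), 0 < t → G n t y →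
      π (Metric.ball (y : X) t) ^ q ≤ ENNReal.ofReal (t ^ (a - c / (n + 1)))) :
    bigLowerDim π K q μ ≤ ((-a : ℝ) : EReal) := by
  choose F t ht0 ht1 hF hcard hmeas using hμ
  refine bigLowerDim_le (c := 1 + c) (fun n => ⋃ y ∈ F n, Metric.ball y (t n)) t
    (fun n => (isOpen_biUnion fun _ _ => Metric.isOpen_ball).measurableSet) ht0 ht1 hmeas
    fun n => ?_
  refine (coverSum_le_sum π q (F n) ?_).trans ?_
  · rintro _ ⟨x, hx, rfl⟩
    obtain ⟨y, hy, hxy⟩ := mem_iUnion₂.1 hx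
    exact mem_iUnion₂.2 ⟨y, hy, hxy⟩
  · refine (Finset.sum_le_card_nsmul _ _ _ fun y hy => hG n (t n) y (ht0 n) (hF n y hy)).trans ?_
    have h0 := Real.rpow_pos_of_pos (ht0 n)
    rw [nsmul_eq_mul, ← ENNReal.ofReal_natCast, ← ENNReal.ofReal_mul (Nat.cast_nonneg _)]
    refine ENNReal.ofReal_le_ofReal ((mul_le_mul_of_nonneg_right (hcard n) (h0 _).le).trans ?_)
    rw [← Real.rpow_add (ht0 n)]
    apply le_of_eq; congr 1; ring

theorem eventually_rpow_add_le_mul_rpow {c : ℝ} (hc : 0 < c) (a : ℝ) {δ : ℝ} (hδ : 0 < δ) :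
    ∀ᶠ t in 𝓝[>] (0 : ℝ), t ^ (a + δ) ≤ c * t ^ a := by
  have h : Tendsto (fun t : ℝ => t ^ δ) (𝓝[>] 0) (𝓝 0) := by
    have := (Real.continuousAt_rpow_const 0 δ (Or.inr hδ.le)).tendsto
    rw [Real.zero_rpow hδ.ne'] at this
    exact this.mono_left nhdsWithin_le_nhds
  filter_upwards [h.eventually_lt_const hc, eventually_mem_nhdsWithin] with t ht h0
  rw [Real.rpow_add h0, mul_comm]
  exact mul_le_mul_of_nonneg_right ht.le (Real.rpow_pos_of_pos h0 a).le

theorem eventually_mul_rpow_le_rpow_sub {C : ℝ} (hC : 0 < C) (a : ℝ) {δ : ℝ} (hδ : 0 < δ) :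
    ∀ᶠ t in 𝓝[>] (0 : ℝ), C * t ^ a ≤ t ^ (a - δ) := by
  filter_upwards [eventually_rpow_add_le_mul_rpow (inv_pos.2 hC) (a - δ) hδ] with t ht
  rwa [sub_add_cancel, le_inv_mul_iff₀ hC] at ht

theorem le_smallLowerDim {X : Type*} [PseudoMetricSpace X] [MeasurableSpace X]
    {π : Measure X} {K : Set X} {q a : ℝ} (μ : ProbabilityMeasure K)
    (h : ∀ δ > 0, ∀ᶠ t in 𝓝[>] (0 : ℝ), ∀ x ∈ K,
      ENNReal.ofReal (t ^ (a + δ)) ≤ π (Metric.ball x t) ^ q) :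
    ((-a : ℝ) : EReal) ≤ smallLowerDim π K q μ := by
  refine le_iInf fun E => le_iInf fun _ => le_iInf fun hE =>
    le_lowerMultifractalBoxDim fun δ hδ => ?_
  have hne : (Subtype.val '' E).Nonempty := by
    refine (nonempty_iff_ne_empty.2 ?_).image _
    rintro rfl
    simp at hE
  filter_upwards [h δ hδ] with t ht using le_coverSum hne ht

theorem ofReal_rpow_rpow {t : ℝ} (ht : 0 < t) (s q : ℝ) :
    ENNReal.ofReal (t ^ s) ^ q = ENNReal.ofReal (t ^ (s * q)) := by
  rw [ENNReal.ofReal_rpow_of_pos (Real.rpow_pos_of_pos ht s), Real.rpow_mul ht.le]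

theorem ENNReal.rpow_le_rpow_of_nonpos {a b : ℝ≥0∞} (h : a ≤ b) {q : ℝ} (hq : q ≤ 0) :
    b ^ q ≤ a ^ q := by
  rw [← neg_neg q, ENNReal.rpow_neg b, ENNReal.rpow_neg a]
  exact ENNReal.inv_le_inv.2 (ENNReal.rpow_le_rpow h (neg_nonneg.2 hq))

/-- The typical dimensions follow from power bounds on the `π`-mass of balls: uniform bounds with
exponents `smax` from below and `smin` from above, and, near every point of `K` and at every small
scale, the existence of balls for which these exponents are attained. The constants may depend on
the point in the latter case. -/
theorem typically_lowerDim_eq {X : Type*} [MetricSpace X] [MeasurableSpace X] [BorelSpace X]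
    {π : Measure X} {K : Set X} (hK : IsCompact K) {smin smax : ℝ}
    (hlow : ∃ c > 0, ∀ᶠ t in 𝓝[>] (0 : ℝ), ∀ x ∈ K,
      ENNReal.ofReal (c * t ^ smax) ≤ π (Metric.ball x t))
    (hup : ∃ C > 0, ∀ᶠ t in 𝓝[>] (0 : ℝ), ∀ x ∈ K,
      π (Metric.ball x t) ≤ ENNReal.ofReal (C * t ^ smin))
    (hthin : ∀ x ∈ K, ∀ η > 0, ∃ C > 0, ∀ᶠ t in 𝓝[>] (0 : ℝ), ∃ y ∈ K, dist y x < η ∧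
      π (Metric.ball y t) ≤ ENNReal.ofReal (C * t ^ smax))
    (hthick : ∀ x ∈ K, ∀ η > 0, ∃ c > 0, ∀ᶠ t in 𝓝[>] (0 : ℝ), ∃ y ∈ K, dist y x < η ∧
      ENNReal.ofReal (c * t ^ smin) ≤ π (Metric.ball y t)) :
    Typically fun μ : ProbabilityMeasure K =>
      (∀ q : ℝ, 0 ≤ q →
        smallLowerDim π K q μ = ((-smax * q : ℝ) : EReal) ∧
        bigLowerDim π K q μ = ((-smax * q : ℝ) : EReal)) ∧
      (∀ q : ℝ, q ≤ 0 →
        smallLowerDim π K q μ = ((-smin * q : ℝ) : EReal) ∧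
        bigLowerDim π K q μ = ((-smin * q : ℝ) : EReal)) := by
  have : CompactSpace K := isCompact_iff_compactSpace.1 hK
  have hn : ∀ n : ℕ, (0 : ℝ) < 1 / (n + 1) := fun n => by positivity
  have h3 := typically_isConcentrated (Y := K)
    (fun n t y => π (Metric.ball (y : X) t) ≤ ENNReal.ofReal (t ^ (smax - 1 / (n + 1)))) (by
      intro n x η hη
      obtain ⟨C, hC, h⟩ := hthin x x.2 η hη
      filter_upwards [h, eventually_mul_rpow_le_rpow_sub hC smax (hn n)] with t ⟨y, hy, hd, hb⟩ ht
      exact ⟨⟨y, hy⟩, hd, hb.trans (ENNReal.ofReal_le_ofReal ht)⟩)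
  have h4 := typically_isConcentrated (Y := K)
    (fun n t y => ENNReal.ofReal (t ^ (smin + 1 / (n + 1))) ≤ π (Metric.ball (y : X) t)) (by
      intro n x η hη
      obtain ⟨C, hC, h⟩ := hthick x x.2 η hη
      filter_upwards [h, eventually_rpow_add_le_mul_rpow hC smin (hn n)] with t ⟨y, hy, hd, hb⟩ ht
      exact ⟨⟨y, hy⟩, hd, (ENNReal.ofReal_le_ofReal ht).trans hb⟩)
  obtain ⟨R, hR, hRd, hRP⟩ := h3.and h4
  have hlt1 : ∀ᶠ t in 𝓝[>] (0 : ℝ), t < 1 :=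
    (eventually_lt_nhds one_pos).filter_mono nhdsWithin_le_nhds
  have conc : ∀ (μ : ProbabilityMeasure K) (q b : ℝ), ((-b : ℝ) : EReal) ≤ smallLowerDim π K q μ →
      bigLowerDim π K q μ ≤ ((-b : ℝ) : EReal) →
      smallLowerDim π K q μ = ((-b : ℝ) : EReal) ∧ bigLowerDim π K q μ = ((-b : ℝ) : EReal) :=
    fun μ q b hl hu => ⟨((smallLowerDim_le_bigLowerDim π K q μ).trans hu).antisymm hl,
      hu.antisymm (hl.trans (smallLowerDim_le_bigLowerDim π K q μ))⟩
  refine ⟨R, hR, hRd, fun μ hμ => ⟨fun q hq => ?_, fun q hq => ?_⟩⟩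
  · rw [neg_mul]
    refine conc μ q _ (le_smallLowerDim μ fun δ hδ => ?_)
      (bigLowerDim_le_of_isConcentrated (c := q) (hRP μ hμ).1 fun n t y ht hy => ?_)
    · obtain ⟨c, hc, h⟩ := hlow
      have hδ' : 0 < δ / (q + 1) := by positivity
      filter_upwards [h, eventually_rpow_add_le_mul_rpow hc smax hδ', eventually_mem_nhdsWithin,
        hlt1] with t h1 h2 h0 hlt x hx
      refine le_trans ?_ (ENNReal.rpow_le_rpow ((ENNReal.ofReal_le_ofReal h2).trans (h1 x hx)) hq)
      rw [ofReal_rpow_rpow h0]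
      refine ENNReal.ofReal_le_ofReal (Real.rpow_le_rpow_of_exponent_ge h0 hlt.le ?_)
      have : δ / (q + 1) * q ≤ δ := by
        rw [div_mul_eq_mul_div, div_le_iff₀ (by positivity)]
        nlinarith
      linarith
    · refine (ENNReal.rpow_le_rpow hy hq).trans (le_of_eq ?_)
      rw [ofReal_rpow_rpow ht]
      congr 2; ring
  · rw [neg_mul]
    refine conc μ q _ (le_smallLowerDim μ fun δ hδ => ?_)
      (bigLowerDim_le_of_isConcentrated (c := -q) (hRP μ hμ).2 fun n t y ht hy => ?_)
    · obtain ⟨C, hC, h⟩ := hup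
      have hq1 : 0 < 1 - q := by linarith
      have hδ' : 0 < δ / (1 - q) := div_pos hδ hq1
      filter_upwards [h, eventually_mul_rpow_le_rpow_sub hC smin hδ', eventually_mem_nhdsWithin,
        hlt1] with t h1 h2 h0 hlt x hx
      refine le_trans ?_ (ENNReal.rpow_le_rpow_of_nonpos
        ((h1 x hx).trans (ENNReal.ofReal_le_ofReal h2)) hq)
      rw [ofReal_rpow_rpow h0]
      refine ENNReal.ofReal_le_ofReal (Real.rpow_le_rpow_of_exponent_ge h0 hlt.le ?_)
      have : δ / (1 - q) * (-q) ≤ δ := by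
        rw [div_mul_eq_mul_div, div_le_iff₀ hq1]
        nlinarith
      linarith
    · refine (ENNReal.rpow_le_rpow_of_nonpos hy hq).trans (le_of_eq ?_)
      rw [ofReal_rpow_rpow ht]
      congr 2; ring

/-! ### Similarities of Euclidean space -/

section Similarity

variable {d : ℕ} {f : EuclideanSpace ℝ (Fin d) → EuclideanSpace ℝ (Fin d)} {ρ : ℝ}

theorem exists_linearIsometryEquiv_of_dist_eq (hρ : 0 < ρ)
    (hf : ∀ x y, dist (f x) (f y) = ρ * dist x y) :
    ∃ L : EuclideanSpace ℝ (Fin d) ≃ₗᵢ[ℝ] EuclideanSpace ℝ (Fin d), ∀ x, f x = f 0 + ρ • L x := by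
  have hiso : Isometry fun x => ρ⁻¹ • f x := Isometry.of_dist_eq fun x y => by
    rw [dist_smul₀, hf, Real.norm_of_nonneg (inv_pos.2 hρ).le, inv_mul_cancel_left₀ hρ.ne']
  let g := hiso.affineIsometryOfStrictConvexSpace
  refine ⟨g.linearIsometry.toLinearIsometryEquiv rfl, fun x => ?_⟩
  have h := g.map_vadd 0 x
  have h1 : ∀ y, g y = ρ⁻¹ • f y := fun y => rfl
  rw [h1, h1] at h
  have h2 : ρ⁻¹ • f x = g.linearIsometry x + ρ⁻¹ • f 0 := by simpa using h
  have h3 : f x = ρ • (ρ⁻¹ • f x) := by rw [smul_inv_smul₀ hρ.ne']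
  rw [h3, h2, smul_add, smul_inv_smul₀ hρ.ne', add_comm]
  rfl

theorem surjective_of_dist_eq (hρ : 0 < ρ) (hf : ∀ x y, dist (f x) (f y) = ρ * dist x y) :
    Function.Surjective f := by
  obtain ⟨L, hL⟩ := exists_linearIsometryEquiv_of_dist_eq hρ hf
  intro y
  refine ⟨L.symm (ρ⁻¹ • (y - f 0)), ?_⟩
  rw [hL, L.apply_symm_apply, smul_inv_smul₀ hρ.ne', add_sub_cancel]

theorem volume_image_of_dist_eq (hρ : 0 < ρ) (hf : ∀ x y, dist (f x) (f y) = ρ * dist x y)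
    (A : Set (EuclideanSpace ℝ (Fin d))) :
    volume (f '' A) = ENNReal.ofReal (ρ ^ d) * volume A := by
  obtain ⟨L, hL⟩ := exists_linearIsometryEquiv_of_dist_eq hρ hf
  have : f '' A = (fun z => f 0 + z) '' ((fun z => ρ • z) '' (L '' A)) := by
    rw [image_image, image_image]
    exact image_congr fun x _ => hL x
  rw [this, image_add_left, measure_preimage_add, image_smul,
    Measure.addHaar_smul_of_nonneg _ hρ.le, finrank_euclideanSpace_fin]
  congr 1
  have h2 : L '' A = L.symm ⁻¹' A := L.toEquiv.image_eq_preimage_symm A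
  rw [h2]
  exact L.symm.measurePreserving.measure_preimage_equiv
    (f := L.symm.toHomeomorph.toMeasurableEquiv) A

end Similarity

/-! ### Self-similar sets and measures -/

section SelfSimilar

variable {X ι : Type*} [MetricSpace X] {S : ι → X → X} {r : ι → ℝ} {K : Set X}

theorem IsSimilaritySystem.continuous (hS : IsSimilaritySystem S r) (m : ι) : Continuous (S m) := by
  have : LipschitzWith (r m).toNNReal (S m) := LipschitzWith.of_dist_le_mul fun x y => by
    rw [Real.coe_toNNReal _ (hS m).1.le, (hS m).2.2]
  exact this.continuous

theorem IsSimilaritySystem.preimage_ball (hS : IsSimilaritySystem S r) (m : ι) (x : X) (t : ℝ) :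
    S m ⁻¹' Metric.ball (S m x) t = Metric.ball x (t / r m) := by
  ext y
  rw [mem_preimage, Metric.mem_ball, Metric.mem_ball, (hS m).2.2, lt_div_iff₀ (hS m).1, mul_comm]

theorem IsSelfSimilarSet.apply_mem (hK : IsSelfSimilarSet S K) (m : ι) {x : X} (hx : x ∈ K) :
    S m x ∈ K := by
  rw [hK.2.2]
  exact mem_iUnion.2 ⟨m, mem_image_of_mem _ hx⟩

theorem IsSelfSimilarSet.exists_apply_eq (hK : IsSelfSimilarSet S K) {x : X} (hx : x ∈ K) :
    ∃ m, ∃ y ∈ K, S m y = x := by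
  rw [hK.2.2] at hx
  exact mem_iUnion.1 hx

theorem IsSimilaritySystem.infDist_le (hS : IsSimilaritySystem S r) (hK : IsSelfSimilarSet S K)
    (m : ι) (x : X) : Metric.infDist (S m x) K ≤ r m * Metric.infDist x K := by
  refine le_of_forall_pos_lt_add fun ε hε => ?_
  have hr := (hS m).1
  obtain ⟨y, hy, hxy⟩ := (Metric.infDist_lt_iff hK.2.1).1
    (lt_add_of_pos_right (Metric.infDist x K) (div_pos hε hr))
  calc Metric.infDist (S m x) K ≤ dist (S m x) (S m y) :=
        Metric.infDist_le_dist_of_mem (hK.apply_mem m hy)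
    _ = r m * dist x y := (hS m).2.2 x y
    _ < r m * (Metric.infDist x K + ε / r m) := by gcongr
    _ = _ := by field_simp

theorem IsSimilaritySystem.exists_ratio_bounds [Finite ι] [Nonempty ι]
    (hS : IsSimilaritySystem S r) :
    ∃ a b : ℝ, 0 < a ∧ a ≤ 1 ∧ 0 < b ∧ b < 1 ∧ ∀ m, a ≤ r m ∧ r m ≤ b := by
  obtain ⟨i, hi⟩ := Finite.exists_min r
  obtain ⟨j, hj⟩ := Finite.exists_max r
  exact ⟨r i, r j, (hS i).1, (hS i).2.1.le, (hS j).1, (hS j).2.1, fun m => ⟨hi m, hj m⟩⟩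

variable [Fintype ι] [MeasurableSpace X] [BorelSpace X] {p : ι → ℝ} {π : Measure X}

theorem IsSelfSimilarMeasure.apply_eq_sum (hπ : IsSelfSimilarMeasure S p π)
    (hS : IsSimilaritySystem S r) {A : Set X} (hA : MeasurableSet A) :
    π A = ∑ m, ENNReal.ofReal (p m) * π (S m ⁻¹' A) := by
  conv_lhs => rw [hπ.2]
  simp only [Measure.coe_finsetSum, Finset.sum_apply, Measure.smul_apply, smul_eq_mul]
  exact Finset.sum_congr rfl fun m _ => by rw [Measure.map_apply (hS.continuous m).measurable hA]

theorem IsSelfSimilarMeasure.mul_le_apply (hπ : IsSelfSimilarMeasure S p π)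
    (hS : IsSimilaritySystem S r) {A : Set X} (hA : MeasurableSet A) (m : ι) :
    ENNReal.ofReal (p m) * π (S m ⁻¹' A) ≤ π A := by
  rw [hπ.apply_eq_sum hS hA]
  exact Finset.single_le_sum (f := fun m => ENNReal.ofReal (p m) * π (S m ⁻¹' A))
    (fun _ _ => zero_le) (Finset.mem_univ m)

theorem IsSelfSimilarMeasure.measure_compl_eq_zero [Nonempty ι] (hπ : IsSelfSimilarMeasure S p π)
    (hS : IsSimilaritySystem S r) (hK : IsSelfSimilarSet S K) (hp : ∀ m, 0 < p m)
    (hp1 : ∑ m, p m = 1) : π Kᶜ = 0 := by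
  have := hπ.1
  obtain ⟨_, b, _, _, hb, hb1, hr⟩ := hS.exists_ratio_bounds
  have hmeas : ∀ t : ℝ, MeasurableSet {x | t < Metric.infDist x K} := fun t =>
    (isOpen_lt continuous_const (Metric.continuous_infDist_pt K)).measurableSet
  -- Every map multiplies the distance to `K` by at most `b`, and `π` is invariant.
  have hstep : ∀ t : ℝ, π {x | t < Metric.infDist x K} ≤ π {x | t / b < Metric.infDist x K} := by
    intro t
    rw [hπ.apply_eq_sum hS (hmeas t)]
    calc ∑ m, ENNReal.ofReal (p m) * π (S m ⁻¹' {x | t < Metric.infDist x K})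
        ≤ ∑ m, ENNReal.ofReal (p m) * π {x | t / b < Metric.infDist x K} := by
          refine Finset.sum_le_sum fun m _ => mul_le_mul_right (measure_mono fun x hx => ?_) _
          have hx' : t < Metric.infDist (S m x) K := hx
          rw [mem_ofPred_eq, div_lt_iff₀ hb, mul_comm]
          exact hx'.trans_le ((hS.infDist_le hK m x).trans
            (mul_le_mul_of_nonneg_right (hr m).2 Metric.infDist_nonneg))
      _ = _ := by
          rw [← Finset.sum_mul, ← ENNReal.ofReal_sum_of_nonneg fun m _ => (hp m).le, hp1,
            ENNReal.ofReal_one, one_mul]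
  have hnull : ∀ t : ℝ, 0 < t → π {x | t < Metric.infDist x K} = 0 := by
    intro t ht
    have hle : ∀ n : ℕ,
        π {x | t < Metric.infDist x K} ≤ π {x | t / b ^ n < Metric.infDist x K} := by
      intro n
      induction n with
      | zero => simp
      | succ n ih =>
        refine ih.trans ((hstep _).trans (le_of_eq ?_))
        rw [div_div, pow_succ]
    have hanti : Antitone fun n : ℕ => {x | t / b ^ n < Metric.infDist x K} := by
      intro n k hnk x hx
      have hx : t / b ^ k < Metric.infDist x K := hx
      refine lt_of_le_of_lt ?_ hx
      exact div_le_div_of_nonneg_left ht.le (pow_pos hb k) (pow_le_pow_of_le_one hb.le hb1.le hnk)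
    have hlim := tendsto_measure_iInter_atTop (μ := π)
      (fun n : ℕ => (hmeas (t / b ^ n)).nullMeasurableSet) hanti ⟨0, measure_ne_top _ _⟩
    have hempty : ⋂ n : ℕ, {x | t / b ^ n < Metric.infDist x K} = ∅ := by
      refine eq_empty_of_forall_notMem fun x hx => ?_
      obtain ⟨n, hn⟩ := exists_pow_lt_of_lt_one
        (div_pos ht (show 0 < Metric.infDist x K + 1 by
          linarith [Metric.infDist_nonneg (x := x) (s := K)])) hb1
      have h1 : t / b ^ n < Metric.infDist x K := mem_iInter.1 hx n
      have h2 : (0 : ℝ) ≤ Metric.infDist x K := Metric.infDist_nonneg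
      rw [div_lt_iff₀ (pow_pos hb n)] at h1
      rw [lt_div_iff₀ (by linarith)] at hn
      nlinarith [pow_pos hb n]
    rw [hempty, measure_empty] at hlim
    exact le_antisymm (ge_of_tendsto' hlim hle) zero_le
  have hsub : Kᶜ ⊆ ⋃ n : ℕ, {x | (1 : ℝ) / (n + 1) < Metric.infDist x K} := by
    intro x hx
    have hpos := (hK.1.isClosed.notMem_iff_infDist_pos hK.2.1).1 hx
    obtain ⟨n, hn⟩ := exists_nat_one_div_lt hpos
    exact mem_iUnion.2 ⟨n, hn⟩
  exact measure_mono_null hsub (measure_iUnion_null fun n => hnull _ (by positivity))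

theorem IsSelfSimilarMeasure.measure_eq_zero_of_disjoint [Nonempty ι]
    (hπ : IsSelfSimilarMeasure S p π)
    (hS : IsSimilaritySystem S r) (hK : IsSelfSimilarSet S K) (hp : ∀ m, 0 < p m)
    (hp1 : ∑ m, p m = 1) {A : Set X} (hA : ∀ x ∈ K, x ∉ A) : π A = 0 :=
  measure_mono_null (fun x hx hxK => hA x hxK hx) (hπ.measure_compl_eq_zero hS hK hp hp1)

theorem IsSelfSimilarMeasure.measure_eq_one_of_subset [Nonempty ι]
    (hπ : IsSelfSimilarMeasure S p π)
    (hS : IsSimilaritySystem S r) (hK : IsSelfSimilarSet S K) (hp : ∀ m, 0 < p m)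
    (hp1 : ∑ m, p m = 1) {A : Set X} (hA : K ⊆ A) : π A = 1 := by
  have := hπ.1
  have h1 := prob_compl_eq_zero_iff (μ := π) hK.1.isClosed.measurableSet |>.1
    (hπ.measure_compl_eq_zero hS hK hp hp1)
  exact le_antisymm prob_le_one (h1 ▸ measure_mono hA)

/-- On a self-similar set each ball of radius `t` has mass at least a constant times `t ^ s`
whenever all the weights satisfy `r m ^ s ≤ p m`. A ball is at least as heavy as `p m` times
its preimage under `S m`, a larger ball; hence the bound descends from scale to scale. -/
theorem IsSelfSimilarMeasure.exists_le_measure_ball [Nonempty ι] (hπ : IsSelfSimilarMeasure S p π)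
    (hS : IsSimilaritySystem S r) (hK : IsSelfSimilarSet S K) (hp : ∀ m, 0 < p m)
    (hp1 : ∑ m, p m = 1) {s : ℝ} (hs : 0 ≤ s) (hps : ∀ m, r m ^ s ≤ p m) :
    ∃ c > 0, ∀ᶠ t in 𝓝[>] (0 : ℝ), ∀ x ∈ K,
      ENNReal.ofReal (c * t ^ s) ≤ π (Metric.ball x t) := by
  obtain ⟨a, b, ha, ha1, hb, hb1, hr⟩ := hS.exists_ratio_bounds
  obtain ⟨D, hD, hKD⟩ : ∃ D > 0, ∀ x ∈ K, ∀ y ∈ K, dist x y < D := by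
    obtain ⟨C, hC⟩ := Metric.isBounded_iff.1 hK.1.isBounded
    exact ⟨max C 0 + 1, by positivity, fun x hx y hy =>
      (hC hx hy).trans_lt ((le_max_left C 0).trans_lt (lt_add_one _))⟩
  have hT : 0 < D / a := div_pos hD ha
  have hbase : ∀ t, D ≤ t → t ≤ D / a → ∀ x ∈ K,
      ENNReal.ofReal ((t / (D / a)) ^ s) ≤ π (Metric.ball x t) := by
    intro t hDt htT x hx
    have hsub : K ⊆ Metric.ball x t := fun y hy => (hKD y hy x hx).trans_le hDt
    rw [hπ.measure_eq_one_of_subset hS hK hp hp1 hsub,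
      ENNReal.ofReal_le_one]
    exact Real.rpow_le_one (div_nonneg (hD.le.trans hDt) hT.le) ((div_le_one hT).2 htT) hs
  have hind : ∀ n : ℕ, ∀ t, D * b ^ n ≤ t → t ≤ D / a → ∀ x ∈ K,
      ENNReal.ofReal ((t / (D / a)) ^ s) ≤ π (Metric.ball x t) := by
    intro n
    induction n with
    | zero => simpa using hbase
    | succ n ih =>
      intro t htn htT x hx
      rcases le_or_gt D t with hDt | hDt
      · exact hbase t hDt htT x hx
      obtain ⟨m, y, hy, rfl⟩ := hK.exists_apply_eq hx
      have hrm := (hS m).1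
      have ht : 0 < t := lt_of_lt_of_le (by positivity) htn
      refine le_trans ?_ (hπ.mul_le_apply hS Metric.isOpen_ball.measurableSet m)
      rw [hS.preimage_ball]
      refine le_trans ?_ (mul_le_mul_right (ih (t / r m) ?_ ?_ y hy) _)
      · rw [← ENNReal.ofReal_mul (hp m).le]
        refine ENNReal.ofReal_le_ofReal ?_
        have : t / (D / a) = r m * (t / r m / (D / a)) := by field_simp
        rw [this, Real.mul_rpow hrm.le (by positivity)]
        exact mul_le_mul_of_nonneg_right (hps m) (by positivity)
      · rw [le_div_iff₀ hrm]
        refine le_trans ?_ htn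
        rw [pow_succ, ← mul_assoc]
        exact mul_le_mul_of_nonneg_left (hr m).2 (by positivity)
      · exact div_le_div₀ hD.le hDt.le ha (hr m).1
  refine ⟨(D / a)⁻¹ ^ s, by positivity, ?_⟩
  filter_upwards [eventually_mem_nhdsWithin,
    (eventually_le_nhds hT).filter_mono nhdsWithin_le_nhds] with t ht htT x hx
  have ht : 0 < t := ht
  obtain ⟨n, hn⟩ := exists_pow_lt_of_lt_one (div_pos ht hD) hb1
  rw [lt_div_iff₀ hD, mul_comm] at hn
  have := hind n t hn.le htT x hx
  rwa [div_eq_mul_inv, mul_comm, Real.mul_rpow (by positivity) ht.le] at this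

end SelfSimilar

/-! ### The upper mass bound under the open set condition -/

section Euclidean

variable {d : ℕ} {ι : Type*} {S : ι → EuclideanSpace ℝ (Fin d) → EuclideanSpace ℝ (Fin d)}
  {r : ι → ℝ} {K U : Set (EuclideanSpace ℝ (Fin d))}

theorem IsSelfSimilarSet.exists_dist_lt (hK : IsSelfSimilarSet S K)
    (hUb : Bornology.IsBounded U) : ∃ D > 0, ∀ x ∈ K ∪ U, ∀ y ∈ K ∪ U, dist x y < D := by
  obtain ⟨C, hC⟩ := Metric.isBounded_iff.1 (hK.1.isBounded.union hUb)
  exact ⟨max C 0 + 1, by positivity, fun x hx y hy =>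
    (hC hx hy).trans_lt ((le_max_left C 0).trans_lt (lt_add_one _))⟩

variable [Fintype ι] {p : ι → ℝ} {π : Measure (EuclideanSpace ℝ (Fin d))}

/-- The volume of `U ∩ ball x t` is superadditive under the maps of the system. -/
theorem sum_volume_inter_ball_le (hS : IsSimilaritySystem S r) (hU : IsOpen U)
    (hSU : ∀ m, S m '' U ⊆ U) (hdisj : ∀ l m, l ≠ m → Disjoint (S m '' U) (S l '' U))
    (y : ι → EuclideanSpace ℝ (Fin d)) (x : EuclideanSpace ℝ (Fin d)) (hy : ∀ m, S m (y m) = x)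
    (t : ℝ) :
    ∑ m, ENNReal.ofReal (r m ^ d) * volume (U ∩ Metric.ball (y m) (t / r m)) ≤
      volume (U ∩ Metric.ball x t) := by
  have hinj : ∀ m, Function.Injective (S m) := fun m u v huv => by
    have := (hS m).2.2 u v
    rw [huv, dist_self] at this
    exact dist_eq_zero.1 ((mul_eq_zero.1 this.symm).resolve_left (hS m).1.ne')
  have hmeas : ∀ m, MeasurableSet (S m '' (U ∩ Metric.ball (y m) (t / r m))) := fun m =>
    (hU.inter Metric.isOpen_ball).measurableSet.image_of_continuousOn_injOn
      (hS.continuous m).continuousOn (hinj m).injOn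
  simp only [← volume_image_of_dist_eq (hS _).1 (hS _).2.2]
  rw [← tsum_fintype (L := .unconditional _), ← measure_iUnion (fun m l hml => ?_) hmeas]
  · refine measure_mono (iUnion_subset fun m => ?_)
    rintro _ ⟨u, ⟨huU, hu⟩, rfl⟩
    refine ⟨hSU m (mem_image_of_mem _ huU), ?_⟩
    rw [← hS.preimage_ball, hy] at hu
    exact hu
  · exact (hdisj l m hml.symm).mono (image_mono inter_subset_left) (image_mono inter_subset_left)

/-- Under the open set condition each ball of radius `t` has mass at most a constant times `t ^ s`
whenever all the weights satisfy `p m ≤ r m ^ s`. The proof compares `π (ball x t)` with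
`t ^ (s - d)` times the volume of `U ∩ ball x (2 * t)`: this volume is superadditive under the
maps of the system because the images of `U` are disjoint. -/
theorem IsSelfSimilarMeasure.exists_measure_ball_le [Nonempty ι] (hπ : IsSelfSimilarMeasure S p π)
    (hS : IsSimilaritySystem S r) (hK : IsSelfSimilarSet S K) (hp : ∀ m, 0 < p m)
    (hp1 : ∑ m, p m = 1) (hU : IsOpen U) (hUne : U.Nonempty) (hUb : Bornology.IsBounded U)
    (hSU : ∀ m, S m '' U ⊆ U) (hdisj : ∀ l m, l ≠ m → Disjoint (S m '' U) (S l '' U))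
    {s : ℝ} (hs : 0 ≤ s) (hps : ∀ m, p m ≤ r m ^ s) :
    ∃ C > 0, ∀ᶠ t in 𝓝[>] (0 : ℝ), ∀ x ∈ K,
      π (Metric.ball x t) ≤ ENNReal.ofReal (C * t ^ s) := by
  have := hπ.1
  obtain ⟨a, b, ha, ha1, hb, hb1, hr⟩ := hS.exists_ratio_bounds
  obtain ⟨D, hD, hKD⟩ := hK.exists_dist_lt hUb
  have hT : 0 < D / a := div_pos hD ha
  have hbase : ∀ t, D ≤ t → t ≤ D / a → ∀ x, π (Metric.ball x t) * volume U ≤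
      ENNReal.ofReal ((t / D) ^ s * (D / a / t) ^ d) * volume (U ∩ Metric.ball x (2 * t)) := by
    intro t hDt htT x
    have ht : 0 < t := hD.trans_le hDt
    by_cases hx : ∃ z ∈ K, z ∈ Metric.ball x t
    · obtain ⟨z, hzK, hz⟩ := hx
      have hsub : U ⊆ Metric.ball x (2 * t) := fun u hu => by
        have h1 := hKD u (Or.inr hu) z (Or.inl hzK)
        have h2 : dist z x < t := hz
        have h3 := dist_triangle u z x
        rw [Metric.mem_ball]
        linarith
      rw [inter_eq_left.2 hsub]
      refine mul_le_mul_left (prob_le_one.trans ?_) _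
      rw [ENNReal.one_le_ofReal]
      have h1 : 1 ≤ (t / D) ^ s := Real.one_le_rpow ((one_le_div hD).2 hDt) hs
      have h2 : 1 ≤ (D / a / t) ^ d := one_le_pow₀ ((one_le_div ht).2 htT)
      nlinarith
    · -- A ball that misses `K` has no mass.
      rw [hπ.measure_eq_zero_of_disjoint hS hK hp hp1 fun z hz hzx => hx ⟨z, hz, hzx⟩, zero_mul]
      exact zero_le
  have hind : ∀ n : ℕ, ∀ t, D * b ^ n ≤ t → t ≤ D / a → ∀ x, π (Metric.ball x t) * volume U ≤
      ENNReal.ofReal ((t / D) ^ s * (D / a / t) ^ d) * volume (U ∩ Metric.ball x (2 * t)) := by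
    intro n
    induction n with
    | zero => simpa using hbase
    | succ n ih =>
      intro t htn htT x
      rcases le_or_gt D t with hDt | hDt
      · exact hbase t hDt htT x
      have ht : 0 < t := lt_of_lt_of_le (by positivity) htn
      choose y hy using fun m => surjective_of_dist_eq (hS m).1 (hS m).2.2 x
      have hpre : ∀ m, S m ⁻¹' Metric.ball x t = Metric.ball (y m) (t / r m) := fun m => by
        rw [← hS.preimage_ball, hy]
      rw [hπ.apply_eq_sum hS Metric.isOpen_ball.measurableSet, Finset.sum_mul]
      refine le_trans ?_ (mul_le_mul_right
        (sum_volume_inter_ball_le hS hU hSU hdisj y x hy (2 * t)) _)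
      rw [Finset.mul_sum]
      refine Finset.sum_le_sum fun m _ => ?_
      have hrm := (hS m).1
      have h1 : D * b ^ n ≤ t / r m := by
        rw [le_div_iff₀ hrm]
        refine le_trans ?_ htn
        rw [pow_succ, ← mul_assoc]
        exact mul_le_mul_of_nonneg_left (hr m).2 (by positivity)
      have h2 := ih (t / r m) h1 (div_le_div₀ hD.le hDt.le ha (hr m).1) (y m)
      rw [hpre, mul_assoc]
      refine (mul_le_mul_right h2 _).trans ?_
      rw [← mul_assoc, ← mul_assoc, ← mul_div_assoc, ← ENNReal.ofReal_mul (hp m).le,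
        ← ENNReal.ofReal_mul (by positivity)]
      refine mul_le_mul_left (ENNReal.ofReal_le_ofReal ?_) _
      have e1 : t / D = r m * (t / r m / D) := by field_simp
      have e2 : D / a / (t / r m) = r m * (D / a / t) := by field_simp
      rw [e2, e1, Real.mul_rpow hrm.le (by positivity), mul_pow]
      have h3 : 0 ≤ (t / r m / D) ^ s * (r m ^ d * (D / a / t) ^ d) := by positivity
      calc _ ≤ r m ^ s * ((t / r m / D) ^ s * (r m ^ d * (D / a / t) ^ d)) :=
            mul_le_mul_of_nonneg_right (hps m) h3
        _ = _ := by ring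
  have hU0 : volume U ≠ 0 := (hU.measure_pos volume hUne).ne'
  have hUtop : volume U ≠ ∞ := hUb.measure_lt_top.ne
  have hB : volume (Metric.ball (0 : EuclideanSpace ℝ (Fin d)) 1) ≠ ∞ := measure_ball_lt_top.ne
  have hB0 : volume (Metric.ball (0 : EuclideanSpace ℝ (Fin d)) 1) ≠ 0 :=
    (Metric.measure_ball_pos _ _ one_pos).ne'
  set v := volume.real U with hv
  set β := volume.real (Metric.ball (0 : EuclideanSpace ℝ (Fin d)) 1) with hβ
  have hv0 : 0 < v := ENNReal.toReal_pos hU0 hUtop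
  have hβ0 : 0 < β := ENNReal.toReal_pos hB0 hB
  refine ⟨D⁻¹ ^ s * (D / a) ^ d * 2 ^ d * β / v, by positivity, ?_⟩
  filter_upwards [eventually_mem_nhdsWithin,
    (eventually_le_nhds hT).filter_mono nhdsWithin_le_nhds] with t ht htT x _
  have ht : 0 < t := ht
  obtain ⟨n, hn⟩ := exists_pow_lt_of_lt_one (div_pos ht hD) hb1
  rw [lt_div_iff₀ hD, mul_comm] at hn
  have h1 := (hind n t hn.le htT x).trans (mul_le_mul_right (measure_mono inter_subset_right) _)
  rw [Measure.addHaar_ball_of_pos volume _ (by positivity), finrank_euclideanSpace_fin,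
    ← ENNReal.ofReal_toReal hUtop, ← ENNReal.ofReal_toReal hB, ← ENNReal.ofReal_mul (by positivity),
    ← ENNReal.ofReal_mul (by positivity), ← ENNReal.ofReal_toReal (measure_ne_top π _),
    ← ENNReal.ofReal_mul ENNReal.toReal_nonneg] at h1
  rw [ENNReal.ofReal_le_ofReal_iff (by positivity)] at h1
  rw [← ENNReal.ofReal_toReal (measure_ne_top π _)]
  refine ENNReal.ofReal_le_ofReal ?_
  rw [div_mul_eq_mul_div, le_div_iff₀ hv0]
  refine h1.trans (le_of_eq ?_)
  have e : (t / D) ^ s = t ^ s * D⁻¹ ^ s := by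
    rw [div_eq_mul_inv, Real.mul_rpow ht.le (by positivity)]
  rw [e, div_pow, mul_pow, ← measureReal_def, ← hβ]
  field_simp

end Euclidean

/-! ### Words and cylinders -/

/-- The composition `S m₁ ∘ ⋯ ∘ S mₖ` along the word `[m₁, …, mₖ]`. -/
def wordMap {X ι : Type*} (S : ι → X → X) : List ι → X → X
  | [] => id
  | m :: w => S m ∘ wordMap S w

/-- The product `r m₁ ⋯ r mₖ` along the word `[m₁, …, mₖ]`. -/
def wordProd {ι : Type*} (r : ι → ℝ) (w : List ι) : ℝ := (w.map r).prod

section Words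

variable {X ι : Type*} {S : ι → X → X} {r : ι → ℝ} {K : Set X}

@[simp] theorem wordMap_nil : wordMap S [] = id := rfl

theorem wordMap_cons (m : ι) (w : List ι) : wordMap S (m :: w) = S m ∘ wordMap S w := rfl

theorem wordMap_append (v w : List ι) : wordMap S (v ++ w) = wordMap S v ∘ wordMap S w := by
  induction v with
  | nil => rfl
  | cons m v ih => rw [List.cons_append, wordMap_cons, ih, wordMap_cons, Function.comp_assoc]

@[simp] theorem wordProd_nil : wordProd r [] = 1 := rfl

theorem wordProd_cons (m : ι) (w : List ι) : wordProd r (m :: w) = r m * wordProd r w := by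
  simp [wordProd]

theorem wordProd_append (v w : List ι) : wordProd r (v ++ w) = wordProd r v * wordProd r w := by
  simp [wordProd]

theorem wordProd_replicate (m : ι) (k : ℕ) : wordProd r (List.replicate k m) = r m ^ k := by
  simp [wordProd]

theorem wordProd_pos (hr : ∀ m, 0 < r m) (w : List ι) : 0 < wordProd r w := by
  induction w with
  | nil => simp
  | cons m w ih => rw [wordProd_cons]; exact mul_pos (hr m) ih

theorem wordProd_le_one (hr : ∀ m, 0 < r m) (hr1 : ∀ m, r m ≤ 1) (w : List ι) :
    wordProd r w ≤ 1 := by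
  induction w with
  | nil => simp
  | cons m w ih => rw [wordProd_cons]; exact mul_le_one₀ (hr1 m) (wordProd_pos hr w).le ih

theorem wordProd_le_pow (hr : ∀ m, 0 < r m) {b : ℝ} (hb : ∀ m, r m ≤ b) (w : List ι) :
    wordProd r w ≤ b ^ w.length := by
  induction w with
  | nil => simp
  | cons m w ih =>
    rw [wordProd_cons, List.length_cons, pow_succ, mul_comm]
    exact mul_le_mul ih (hb m) (hr m).le ((wordProd_pos hr w).le.trans ih)

theorem wordMap_image_subset {U : Set X} (hSU : ∀ m, S m '' U ⊆ U) (w : List ι) :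
    wordMap S w '' U ⊆ U := by
  induction w with
  | nil => simp
  | cons m w ih =>
    rw [wordMap_cons, image_comp]
    exact (image_mono ih).trans (hSU m)

variable [MetricSpace X]

theorem IsSimilaritySystem.dist_wordMap (hS : IsSimilaritySystem S r) (w : List ι) (x y : X) :
    dist (wordMap S w x) (wordMap S w y) = wordProd r w * dist x y := by
  induction w with
  | nil => simp
  | cons m w ih =>
    rw [wordMap_cons, Function.comp_apply, Function.comp_apply, (hS m).2.2, ih, wordProd_cons,
      mul_assoc]

theorem IsSimilaritySystem.injective_wordMap (hS : IsSimilaritySystem S r) (w : List ι) :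
    Function.Injective (wordMap S w) := fun u v huv => by
  have := hS.dist_wordMap w u v
  rw [huv, dist_self] at this
  exact dist_eq_zero.1 ((mul_eq_zero.1 this.symm).resolve_left
    (wordProd_pos (fun m => (hS m).1) w).ne')

theorem IsSelfSimilarSet.wordMap_mem (hK : IsSelfSimilarSet S K) (w : List ι) {x : X}
    (hx : x ∈ K) : wordMap S w x ∈ K :=
  wordMap_image_subset (fun m => image_subset_iff.2 fun _ hy => hK.apply_mem m hy) w
    (mem_image_of_mem _ hx)

theorem IsSelfSimilarSet.exists_wordMap_eq (hK : IsSelfSimilarSet S K) {x : X} (hx : x ∈ K)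
    (n : ℕ) : ∃ w : List ι, w.length = n ∧ ∃ y ∈ K, wordMap S w y = x := by
  induction n generalizing x with
  | zero => exact ⟨[], rfl, x, hx, rfl⟩
  | succ n ih =>
    obtain ⟨m, y, hy, rfl⟩ := hK.exists_apply_eq hx
    obtain ⟨w, hw, z, hz, rfl⟩ := ih hy
    exact ⟨m :: w, by rw [List.length_cons, hw], z, hz, rfl⟩

/-- A point of `wordMap S w '' K` lies in a cylinder below `w` of size comparable to `t`. -/
theorem IsSelfSimilarSet.exists_append_mem (hS : IsSimilaritySystem S r)
    (hK : IsSelfSimilarSet S K) {a b : ℝ} (hb1 : b < 1)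
    (hr : ∀ m, a ≤ r m ∧ r m ≤ b) {t : ℝ} (ht : 0 < t) (w : List ι) {z : X} (hz : z ∈ K)
    (hw : a * t ≤ wordProd r w) :
    ∃ v : List ι, a * t ≤ wordProd r (w ++ v) ∧ wordProd r (w ++ v) ≤ t ∧
      wordMap S w z ∈ wordMap S (w ++ v) '' K := by
  by_contra! H
  -- Otherwise the word could be prolonged for ever with ratios staying above `t`.
  have key : ∀ n : ℕ, ∃ v : List ι, v.length = n ∧ a * t ≤ wordProd r (w ++ v) ∧
      wordMap S w z ∈ wordMap S (w ++ v) '' K := by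
    intro n
    induction n with
    | zero => exact ⟨[], rfl, by simpa using hw, by simpa using mem_image_of_mem _ hz⟩
    | succ n ih =>
      obtain ⟨v, hv, hav, y, hy, hyz⟩ := ih
      have htv : t < wordProd r (w ++ v) := by
        by_contra! hle
        exact H v hav hle ⟨y, hy, hyz⟩
      obtain ⟨m, y', hy', rfl⟩ := hK.exists_apply_eq hy
      refine ⟨v ++ [m], by simp [hv], ?_, y', hy', ?_⟩
      · rw [← List.append_assoc, wordProd_append]
        have : wordProd r [m] = r m := by simp [wordProd]
        rw [this, mul_comm a t]
        have hm := (hS m).1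
        exact (mul_le_mul_of_nonneg_left (hr m).1 ht.le).trans
          (mul_le_mul_of_nonneg_right htv.le hm.le)
      · rw [← List.append_assoc, wordMap_append]
        exact hyz
  have hpos : ∀ m, 0 < r m := fun m => (hS m).1
  obtain ⟨n, hn⟩ := exists_pow_lt_of_lt_one ht hb1
  obtain ⟨v, hv, hav, hmem⟩ := key n
  refine (H v hav ?_) hmem
  rw [wordProd_append]
  calc wordProd r w * wordProd r v ≤ 1 * wordProd r v :=
        mul_le_mul_of_nonneg_right
          (wordProd_le_one hpos (fun m => (hS m).2.1.le) w) (wordProd_pos hpos v).le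
    _ ≤ b ^ n := by rw [one_mul, ← hv]; exact wordProd_le_pow hpos (fun m => (hr m).2) v
    _ ≤ t := hn.le

variable [Fintype ι] [MeasurableSpace X] [BorelSpace X] {p : ι → ℝ} {π : Measure X}

/-- The mass of a set is at most the weight of the word `J` if the set meets no cylinder
`wordMap S I '' K` separated from `J` by the open set `U`. It is enough to consider cylinders
whose ratio is not much smaller than that of `J`. -/
theorem IsSelfSimilarMeasure.measure_le_wordProd [Nonempty ι] (hπ : IsSelfSimilarMeasure S p π)
    (hS : IsSimilaritySystem S r) (hK : IsSelfSimilarSet S K) (hp : ∀ m, 0 < p m)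
    (hp1 : ∑ m, p m = 1) {U : Set X} (hSU : ∀ m, S m '' U ⊆ U)
    (hdisj : ∀ l m, l ≠ m → Disjoint (S m '' U) (S l '' U)) {a : ℝ} (ha : ∀ m, a ≤ r m)
    (J : List ι) {A : Set X} (hA : MeasurableSet A)
    (h : ∀ I, Disjoint (wordMap S I '' U) (wordMap S J '' U) → a * wordProd r J ≤ wordProd r I →
      Disjoint (wordMap S I '' K) A) :
    π A ≤ ENNReal.ofReal (wordProd p J) := by
  have := hπ.1
  have hpos : ∀ m, 0 < r m := fun m => (hS m).1
  induction J generalizing A with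
  | nil => simpa using prob_le_one
  | cons m J ih =>
    have hzero : ∀ l ≠ m, π (S l ⁻¹' A) = 0 := by
      intro l hl
      refine hπ.measure_eq_zero_of_disjoint hS hK hp hp1 fun x hx hxA => ?_
      refine disjoint_left.1 (h [l] ?_ ?_) (mem_image_of_mem _ hx) hxA
      · rw [wordMap_cons m J, image_comp, wordMap_cons, image_comp, wordMap_nil, image_id]
        exact (hdisj m l hl.symm).mono_right (image_mono (wordMap_image_subset hSU J))
      · have h1 := wordProd_le_one hpos (fun m => (hS m).2.1.le) (m :: J)
        have h0 := wordProd_pos hpos (m :: J)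
        rw [wordProd_cons l, wordProd_nil, mul_one]
        refine le_trans ?_ (mul_le_of_le_one_right (hpos l).le h1)
        exact mul_le_mul_of_nonneg_right (ha l) h0.le
    rw [hπ.apply_eq_sum hS hA, Finset.sum_eq_single m (fun l _ hl => by rw [hzero l hl, mul_zero])
      (fun hm => absurd (Finset.mem_univ m) hm), wordProd_cons, ENNReal.ofReal_mul (hp m).le]
    refine mul_le_mul_right (ih ((hS.continuous m).measurable hA) fun I hI hr => ?_) _
    have h2 := h (m :: I) ?_ ?_
    · rw [wordMap_cons, image_comp] at h2
      exact disjoint_image_left.1 h2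
    · rw [wordMap_cons, wordMap_cons, image_comp, image_comp]
      refine (disjoint_image_iff ?_).2 hI
      simpa [wordMap_cons] using hS.injective_wordMap [m]
    · rw [wordProd_cons, wordProd_cons, mul_left_comm]
      exact mul_le_mul_of_nonneg_left hr (hpos m).le

end Words

/-! ### Cylinders that no other cylinder approaches -/

/-- `W` is a family of words whose cylinders are separated by the open set `U`, have ratios in
`[a * t, t]` and come closer than `t` to the point `x`. -/
structure IsClusterAt {X ι : Type*} [PseudoMetricSpace X] (S : ι → X → X) (r : ι → ℝ)
    (K U : Set X) (a : ℝ) (x : X) (t : ℝ) (W : Finset (List ι)) : Prop where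
  disjoint : ∀ I ∈ W, ∀ J ∈ W, I ≠ J → Disjoint (wordMap S I '' U) (wordMap S J '' U)
  le_ratio : ∀ I ∈ W, a * t ≤ wordProd r I
  ratio_le : ∀ I ∈ W, wordProd r I ≤ t
  meets : ∀ I ∈ W, ∃ z ∈ K, wordMap S I z ∈ Metric.ball x t

section Euclidean

variable {d : ℕ} {ι : Type*} {S : ι → EuclideanSpace ℝ (Fin d) → EuclideanSpace ℝ (Fin d)}
  {r : ι → ℝ} {K U : Set (EuclideanSpace ℝ (Fin d))}

/-- The disjoint images of `U` all have volume comparable to `t ^ d` and lie in a ball of radius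
comparable to `t`, which bounds their number. -/
theorem exists_card_le_of_isClusterAt (hS : IsSimilaritySystem S r) (hK : IsSelfSimilarSet S K)
    (hU : IsOpen U) (hUne : U.Nonempty) (hUb : Bornology.IsBounded U) {a : ℝ} (ha : 0 < a) :
    ∃ N : ℕ, ∀ x t W, 0 < t → IsClusterAt S r K U a x t W → W.card ≤ N := by
  obtain ⟨D, hD, hKD⟩ := hK.exists_dist_lt hUb
  have hU0 : volume U ≠ 0 := (hU.measure_pos volume hUne).ne'
  have hUtop : volume U ≠ ∞ := hUb.measure_lt_top.ne
  have hB : volume (Metric.ball (0 : EuclideanSpace ℝ (Fin d)) 1) ≠ ∞ := measure_ball_lt_top.ne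
  have hpos : ∀ m, 0 < r m := fun m => (hS m).1
  set v := volume.real U with hv
  set β := volume.real (Metric.ball (0 : EuclideanSpace ℝ (Fin d)) 1) with hβ
  have hv0 : 0 < v := ENNReal.toReal_pos hU0 hUtop
  obtain ⟨N, hN⟩ := exists_nat_ge ((1 + D) ^ d * β / (a ^ d * v))
  refine ⟨N, fun x t W ht hW => ?_⟩
  have hmeas : ∀ I ∈ W, MeasurableSet (wordMap S I '' U) := fun I _ => by
    refine hU.measurableSet.image_of_continuousOn_injOn ?_ (hS.injective_wordMap I).injOn
    refine (LipschitzWith.of_dist_le_mul (K := (wordProd r I).toNNReal)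
      fun x y => ?_).continuous.continuousOn
    rw [Real.coe_toNNReal _ (wordProd_pos hpos I).le, hS.dist_wordMap]
  have hsub : (⋃ I ∈ W, wordMap S I '' U) ⊆ Metric.ball x (t * (1 + D)) := by
    refine iUnion₂_subset fun I hI => ?_
    rintro _ ⟨u, hu, rfl⟩
    obtain ⟨z, hz, hzx⟩ := hW.meets I hI
    have h1 := dist_triangle (wordMap S I u) (wordMap S I z) x
    have h2 : wordProd r I * dist u z ≤ t * D :=
      mul_le_mul (hW.ratio_le I hI) (hKD u (Or.inr hu) z (Or.inl hz)).le dist_nonneg ht.le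
    rw [hS.dist_wordMap] at h1
    rw [Metric.mem_ball] at hzx ⊢
    linarith
  have h1 := measure_mono (μ := volume) hsub
  rw [measure_biUnion_finset (fun I hI J hJ hIJ => hW.disjoint I hI J hJ hIJ) hmeas,
    Measure.addHaar_ball_of_pos volume _ (by positivity), finrank_euclideanSpace_fin] at h1
  have h2 : ∀ I ∈ W, ENNReal.ofReal ((a * t) ^ d) * volume U ≤ volume (wordMap S I '' U) := by
    intro I hI
    rw [volume_image_of_dist_eq (wordProd_pos hpos I) (hS.dist_wordMap I)]
    exact mul_le_mul_left (ENNReal.ofReal_le_ofReal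
      (pow_le_pow_left₀ (by positivity) (hW.le_ratio I hI) d)) _
  have h3 := (Finset.card_nsmul_le_sum W _ _ h2).trans h1
  rw [nsmul_eq_mul, ← ENNReal.ofReal_natCast, ← ENNReal.ofReal_toReal hUtop,
    ← ENNReal.ofReal_toReal hB, ← ENNReal.ofReal_mul (by positivity),
    ← ENNReal.ofReal_mul (by positivity), ← ENNReal.ofReal_mul (by positivity),
    ENNReal.ofReal_le_ofReal_iff (by positivity), ← measureReal_def, ← measureReal_def, ← hv, ← hβ,
    mul_pow, mul_pow] at h3
  have h4 : (W.card : ℝ) ≤ (1 + D) ^ d * β / (a ^ d * v) := by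
    rw [le_div_iff₀ (by positivity)]
    refine le_of_mul_le_mul_left ?_ (pow_pos ht d)
    linarith
  exact_mod_cast h4.trans hN

variable [Fintype ι] {p : ι → ℝ} {π : Measure (EuclideanSpace ℝ (Fin d))}

/-- Under the open set condition there are a point `x` of the self-similar set and `ε > 0` such
that, for every word `J`, the ball of radius `ε * r_J` around the image of `x` has mass at most
`p_J`. The pair is chosen so that the number of separated cylinders of size about `ε` near `x` is
as large as possible: a cylinder outside `J` near the image of `x` could be added to the images of
those cylinders. -/
theorem IsSelfSimilarMeasure.exists_measure_ball_wordMap_le [Nonempty ι]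
    (hπ : IsSelfSimilarMeasure S p π)
    (hS : IsSimilaritySystem S r) (hK : IsSelfSimilarSet S K) (hp : ∀ m, 0 < p m)
    (hp1 : ∑ m, p m = 1) (hU : IsOpen U) (hUne : U.Nonempty) (hUb : Bornology.IsBounded U)
    (hSU : ∀ m, S m '' U ⊆ U) (hdisj : ∀ l m, l ≠ m → Disjoint (S m '' U) (S l '' U)) :
    ∃ x ∈ K, ∃ ε > 0, ∀ J, π (Metric.ball (wordMap S J x) (ε * wordProd r J)) ≤
      ENNReal.ofReal (wordProd p J) := by
  classical
  obtain ⟨a, b, ha, ha1, hb, hb1, hr⟩ := hS.exists_ratio_bounds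
  obtain ⟨N, hN⟩ := exists_card_le_of_isClusterAt hS hK hU hUne hUb ha
  have hpos : ∀ m, 0 < r m := fun m => (hS m).1
  let T : Set ℕ :=
    {k | ∃ x ∈ K, ∃ t, 0 < t ∧ t ≤ 1 ∧ ∃ W, IsClusterAt S r K U a x t W ∧ W.card = k}
  have hT0 : T.Nonempty := by
    obtain ⟨x, hx⟩ := hK.2.1
    exact ⟨0, x, hx, 1, one_pos, le_rfl, ∅, ⟨by simp, by simp, by simp, by simp⟩, rfl⟩
  have hTb : BddAbove T := ⟨N, by
    rintro k ⟨x, -, t, ht, -, W, hW, rfl⟩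
    exact hN x t W ht hW⟩
  obtain ⟨x, hx, t, ht, ht1, W, hW, hcard⟩ := Nat.sSup_mem hT0 hTb
  refine ⟨x, hx, t, ht, fun J => ?_⟩
  have hJ := wordProd_pos hpos J
  refine hπ.measure_le_wordProd hS hK hp hp1 hSU hdisj (fun m => (hr m).1) J
    Metric.isOpen_ball.measurableSet fun I hIJ hIr => ?_
  by_contra hmeet
  obtain ⟨_, ⟨z, hz, rfl⟩, hzx⟩ := not_disjoint_iff.1 hmeet
  obtain ⟨v, hv1, hv2, hv3⟩ := hK.exists_append_mem hS hb1 hr (mul_pos ht hJ) I hz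
    (le_trans (mul_le_mul_of_nonneg_left (mul_le_of_le_one_left hJ.le ht1) ha.le) hIr)
  have hsubI : wordMap S (I ++ v) '' U ⊆ wordMap S I '' U := by
    rw [wordMap_append, image_comp]
    exact image_mono (wordMap_image_subset hSU v)
  have hsubJ : ∀ w, wordMap S (J ++ w) '' U ⊆ wordMap S J '' U := fun w => by
    rw [wordMap_append, image_comp]
    exact image_mono (wordMap_image_subset hSU w)
  have hdis : ∀ w, Disjoint (wordMap S (I ++ v) '' U) (wordMap S (J ++ w) '' U) := fun w =>
    hIJ.mono hsubI (hsubJ w)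
  have hnot : I ++ v ∉ W.image (J ++ ·) := by
    intro hmem
    obtain ⟨w, -, hw⟩ := Finset.mem_image.1 hmem
    have h1 := hdis w
    have h2 : J ++ w = I ++ v := hw
    rw [h2, disjoint_self] at h1
    exact (hUne.image _).ne_empty h1
  have hbigger : (W.card + 1) ∈ T := by
    refine ⟨wordMap S J x, hK.wordMap_mem J hx, t * wordProd r J, mul_pos ht hJ,
      mul_le_one₀ ht1 hJ.le (wordProd_le_one hpos (fun m => (hS m).2.1.le) J),
      insert (I ++ v) (W.image (J ++ ·)), ⟨?_, ?_, ?_, ?_⟩, ?_⟩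
    · intro A hA B hB hAB
      rcases Finset.mem_insert.1 hA with rfl | hA
      · rcases Finset.mem_insert.1 hB with rfl | hB
        · exact absurd rfl hAB
        · obtain ⟨w, -, rfl⟩ := Finset.mem_image.1 hB
          exact hdis w
      · obtain ⟨w, hw, rfl⟩ := Finset.mem_image.1 hA
        rcases Finset.mem_insert.1 hB with rfl | hB
        · exact (hdis w).symm
        · obtain ⟨w', hw', rfl⟩ := Finset.mem_image.1 hB
          simp only [wordMap_append, image_comp]
          refine (disjoint_image_iff (hS.injective_wordMap J)).2 (hW.disjoint w hw w' hw' ?_)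
          rintro rfl
          exact hAB rfl
    · intro A hA
      rcases Finset.mem_insert.1 hA with rfl | hA
      · exact hv1
      · obtain ⟨w, hw, rfl⟩ := Finset.mem_image.1 hA
        rw [wordProd_append, ← mul_assoc, mul_comm]
        exact mul_le_mul_of_nonneg_left (hW.le_ratio w hw) hJ.le
    · intro A hA
      rcases Finset.mem_insert.1 hA with rfl | hA
      · exact hv2
      · obtain ⟨w, hw, rfl⟩ := Finset.mem_image.1 hA
        rw [wordProd_append, mul_comm t]
        exact mul_le_mul_of_nonneg_left (hW.ratio_le w hw) hJ.le
    · intro A hA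
      rcases Finset.mem_insert.1 hA with rfl | hA
      · obtain ⟨y, hy, hyz⟩ := hv3
        exact ⟨y, hy, by rwa [hyz]⟩
      · obtain ⟨w, hw, rfl⟩ := Finset.mem_image.1 hA
        obtain ⟨y, hy, hyx⟩ := hW.meets w hw
        refine ⟨y, hy, ?_⟩
        rw [wordMap_append, Function.comp_apply, Metric.mem_ball, hS.dist_wordMap, mul_comm t]
        exact mul_lt_mul_of_pos_left hyx hJ
    · rw [Finset.card_insert_of_notMem hnot,
        Finset.card_image_of_injective _ (List.append_right_injective J)]
  have := le_csSup hTb hbigger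
  omega

end Euclidean

/-! ### Balls with extremal mass near every point -/

section Points

variable {X ι : Type*} [MetricSpace X] {S : ι → X → X} {r : ι → ℝ} {K : Set X}

theorem IsSelfSimilarSet.exists_word_dist_lt [Finite ι] [Nonempty ι] (hK : IsSelfSimilarSet S K)
    (hS : IsSimilaritySystem S r) {x : X} (hx : x ∈ K) {η : ℝ} (hη : 0 < η) :
    ∃ L : List ι, ∀ y ∈ K, dist (wordMap S L y) x < η := by
  obtain ⟨a, b, -, -, hb, hb1, hr⟩ := hS.exists_ratio_bounds
  obtain ⟨C, hC⟩ := Metric.isBounded_iff.1 hK.1.isBounded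
  have hC0 : 0 < max C 0 + 1 := by positivity
  obtain ⟨n, hn⟩ := exists_pow_lt_of_lt_one (div_pos hη hC0) hb1
  rw [lt_div_iff₀ hC0] at hn
  obtain ⟨L, hL, z, hz, rfl⟩ := hK.exists_wordMap_eq hx n
  refine ⟨L, fun y hy => lt_of_le_of_lt ?_ hn⟩
  rw [hS.dist_wordMap, ← hL]
  exact mul_le_mul (wordProd_le_pow (fun m => (hS m).1) (fun m => (hr m).2) L)
    ((hC hy hz).trans ((le_max_left C 0).trans (by linarith))) dist_nonneg (by positivity)

/-- Each small `t` lies between two consecutive terms of the geometric sequence `A * ρ ^ k`. -/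
theorem exists_geometric_bracket {A ρ t : ℝ} (hA : 0 < A) (hρ : 0 < ρ) (hρ1 : ρ < 1) (ht : 0 < t)
    (htA : t ≤ A) : ∃ k : ℕ, A * ρ ^ (k + 1) < t ∧ t ≤ A * ρ ^ k := by
  obtain ⟨k, h1, h2⟩ := exists_nat_pow_near_of_lt_one (div_pos ht hA) ((div_le_one hA).2 htA) hρ hρ1
  rw [lt_div_iff₀ hA, mul_comm] at h1
  rw [div_le_iff₀ hA, mul_comm] at h2
  exact ⟨k, h1, h2⟩

/-- Near every point of the self-similar set there are, at every small scale `t`, balls of mass at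
most a constant times `t ^ s` if the weight of one of the maps is `r m ^ s`, provided that the balls
around the images of one point `x₀` have no more mass than the weight of their word. The centres are
the images of `x₀` under words `L m m ⋯ m`. -/
theorem IsSimilaritySystem.exists_thin_ball [Finite ι] [Nonempty ι]
    [MeasurableSpace X] {p : ι → ℝ} {π : Measure X} (hS : IsSimilaritySystem S r)
    (hK : IsSelfSimilarSet S K) (hp : ∀ m, 0 < p m)
    {x₀ : X} (hx₀ : x₀ ∈ K) {ε : ℝ} (hε : 0 < ε)
    (hball : ∀ J, π (Metric.ball (wordMap S J x₀) (ε * wordProd r J)) ≤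
      ENNReal.ofReal (wordProd p J))
    {s : ℝ} (hs : 0 ≤ s) {m : ι} (hm : p m = r m ^ s) {x : X} (hx : x ∈ K) {η : ℝ} (hη : 0 < η) :
    ∃ C > 0, ∀ᶠ t in 𝓝[>] (0 : ℝ), ∃ y ∈ K, dist y x < η ∧
      π (Metric.ball y t) ≤ ENNReal.ofReal (C * t ^ s) := by
  obtain ⟨L, hL⟩ := hK.exists_word_dist_lt hS hx hη
  have hpos : ∀ m, 0 < r m := fun m => (hS m).1
  have hLr := wordProd_pos hpos L
  have hLp := wordProd_pos hp L
  have hrm := hpos m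
  have hA : 0 < ε * wordProd r L := by positivity
  refine ⟨wordProd p L * (ε * wordProd r L * r m)⁻¹ ^ s, by positivity, ?_⟩
  filter_upwards [eventually_mem_nhdsWithin,
    (eventually_le_nhds hA).filter_mono nhdsWithin_le_nhds] with t ht htA
  have ht : 0 < t := ht
  obtain ⟨k, hk1, hk2⟩ := exists_geometric_bracket hA hrm (hS m).2.1 ht htA
  refine ⟨wordMap S (L ++ List.replicate k m) x₀, hK.wordMap_mem _ hx₀, ?_, ?_⟩
  · rw [wordMap_append]
    exact hL _ (hK.wordMap_mem _ hx₀)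
  refine (measure_mono (Metric.ball_subset_ball ?_)).trans
    ((hball (L ++ List.replicate k m)).trans ?_)
  · rwa [wordProd_append, wordProd_replicate, ← mul_assoc]
  rw [wordProd_append, wordProd_replicate, hm]
  refine ENNReal.ofReal_le_ofReal ?_
  rw [mul_assoc, ← Real.mul_rpow (by positivity) ht.le, ← Real.rpow_natCast, ← Real.rpow_mul hrm.le,
    mul_comm s, Real.rpow_mul hrm.le, Real.rpow_natCast]
  refine mul_le_mul_of_nonneg_left (Real.rpow_le_rpow (by positivity) ?_ hs) hLp.le
  rw [le_inv_mul_iff₀ (by positivity)]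
  refine le_of_eq_of_le ?_ hk1.le
  rw [pow_succ]
  ring

variable [Fintype ι] [MeasurableSpace X] [BorelSpace X] {p : ι → ℝ} {π : Measure X}

theorem IsSelfSimilarMeasure.wordProd_mul_le (hπ : IsSelfSimilarMeasure S p π)
    (hS : IsSimilaritySystem S r) (hp : ∀ m, 0 < p m) (w : List ι) (x : X) (t : ℝ) :
    ENNReal.ofReal (wordProd p w) * π (Metric.ball x (t / wordProd r w)) ≤
      π (Metric.ball (wordMap S w x) t) := by
  induction w generalizing t with
  | nil => simp
  | cons m w ih =>
    refine le_trans ?_ (hπ.mul_le_apply hS Metric.isOpen_ball.measurableSet m)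
    rw [wordMap_cons, Function.comp_apply, hS.preimage_ball, wordProd_cons, wordProd_cons,
      ENNReal.ofReal_mul (hp m).le, mul_assoc, ← div_div]
    exact mul_le_mul_right (ih _) _

/-- Near every point of the self-similar set there are, at every small scale `t`, balls of mass at
least a constant times `t ^ s` if the weight of one of the maps is `r m ^ s`. -/
theorem IsSelfSimilarMeasure.exists_thick_ball [Nonempty ι] (hπ : IsSelfSimilarMeasure S p π)
    (hS : IsSimilaritySystem S r) (hK : IsSelfSimilarSet S K) (hp : ∀ m, 0 < p m)
    (hp1 : ∑ m, p m = 1) {s : ℝ} (hs : 0 ≤ s) {m : ι} (hm : p m = r m ^ s) {x : X} (hx : x ∈ K)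
    {η : ℝ} (hη : 0 < η) :
    ∃ c > 0, ∀ᶠ t in 𝓝[>] (0 : ℝ), ∃ y ∈ K, dist y x < η ∧
      ENNReal.ofReal (c * t ^ s) ≤ π (Metric.ball y t) := by
  obtain ⟨L, hL⟩ := hK.exists_word_dist_lt hS hx hη
  obtain ⟨C, hC⟩ := Metric.isBounded_iff.1 hK.1.isBounded
  have hpos : ∀ m, 0 < r m := fun m => (hS m).1
  set D := max C 0 + 1 with hD
  have hD0 : 0 < D := by positivity
  have hLr := wordProd_pos hpos L
  have hLp := wordProd_pos hp L
  have hrm := hpos m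
  have hA : 0 < wordProd r L * D / r m := by positivity
  refine ⟨wordProd p L * (wordProd r L * D / r m)⁻¹ ^ s, by positivity, ?_⟩
  filter_upwards [eventually_mem_nhdsWithin,
    (eventually_le_nhds hA).filter_mono nhdsWithin_le_nhds] with t ht htA
  have ht : 0 < t := ht
  obtain ⟨k, hk1, hk2⟩ := exists_geometric_bracket hA hrm (hS m).2.1 ht htA
  have hxw := hK.wordMap_mem (List.replicate k m) hx
  refine ⟨wordMap S (L ++ List.replicate k m) x, hK.wordMap_mem _ hx, ?_, ?_⟩
  · rw [wordMap_append]
    exact hL _ hxw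
  refine le_trans ?_ (hπ.wordProd_mul_le hS hp _ x t)
  have hsub : K ⊆ Metric.ball x (t / wordProd r (L ++ List.replicate k m)) := by
    intro y hy
    have h1 : dist y x < D := (hC hy hx).trans_lt ((le_max_left C 0).trans_lt (lt_add_one _))
    rw [Metric.mem_ball]
    refine h1.trans ?_
    rw [wordProd_append, wordProd_replicate, lt_div_iff₀ (by positivity)]
    refine lt_of_eq_of_lt ?_ hk1
    rw [pow_succ]
    field_simp
  rw [hπ.measure_eq_one_of_subset hS hK hp hp1 hsub, mul_one, wordProd_append,
    wordProd_replicate, hm]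
  refine ENNReal.ofReal_le_ofReal ?_
  rw [mul_assoc, ← Real.mul_rpow (by positivity) ht.le, ← Real.rpow_natCast, ← Real.rpow_mul hrm.le,
    mul_comm s, Real.rpow_mul hrm.le, Real.rpow_natCast]
  refine mul_le_mul_of_nonneg_left (Real.rpow_le_rpow (by positivity) ?_ hs) hLp.le
  rwa [inv_mul_le_iff₀ hA]

end Points

/-! ### The typical dimensions -/

theorem mainTheorem5 (d M : ℕ) (hM : 2 ≤ M)
    (S : Fin M → EuclideanSpace ℝ (Fin d) → EuclideanSpace ℝ (Fin d))
    (r p : Fin M → ℝ)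
    (hS : IsSimilaritySystem S r)
    (hp : ∀ m, 0 < p m) (hp1 : ∑ m, p m = 1)
    (K : Set (EuclideanSpace ℝ (Fin d))) (hK : IsSelfSimilarSet S K)
    (π : Measure (EuclideanSpace ℝ (Fin d))) (hπ : IsSelfSimilarMeasure S p π)
    (hOSC : OpenSetCondition S)
    (smin smax : ℝ)
    (hsmin : IsLeast (range fun m => Real.log (p m) / Real.log (r m)) smin)
    (hsmax : IsGreatest (range fun m => Real.log (p m) / Real.log (r m)) smax) :
    Typically fun μ : ProbabilityMeasure K =>
      (∀ q : ℝ, 0 ≤ q →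
        smallLowerDim π K q μ = ((-smax * q : ℝ) : EReal) ∧
        bigLowerDim π K q μ = ((-smax * q : ℝ) : EReal)) ∧
      (∀ q : ℝ, q ≤ 0 →
        smallLowerDim π K q μ = ((-smin * q : ℝ) : EReal) ∧
        bigLowerDim π K q μ = ((-smin * q : ℝ) : EReal)) := by
  have : Nonempty (Fin M) := ⟨⟨0, by omega⟩⟩
  obtain ⟨U, hU, hUne, hUb, hSU, hdisj⟩ := hOSC
  have hlog : ∀ m, Real.log (r m) < 0 := fun m => Real.log_neg (hS m).1 (hS m).2.1
  have hple : ∀ m, p m ≤ 1 := fun m =>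
    hp1 ▸ Finset.single_le_sum (fun i _ => (hp i).le) (Finset.mem_univ m)
  have hexp : ∀ m, 0 ≤ Real.log (p m) / Real.log (r m) := fun m =>
    div_nonneg_of_nonpos (Real.log_nonpos (hp m).le (hple m)) (hlog m).le
  have hpr : ∀ m, p m = r m ^ (Real.log (p m) / Real.log (r m)) := fun m => by
    rw [Real.rpow_def_of_pos (hS m).1, mul_div_cancel₀ _ (hlog m).ne, Real.exp_log (hp m)]
  obtain ⟨i, hi⟩ := hsmin.1
  obtain ⟨j, hj⟩ := hsmax.1
  have hsmin0 : 0 ≤ smin := hi ▸ hexp i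
  have hsmax0 : 0 ≤ smax := hj ▸ hexp j
  have hi' : p i = r i ^ smin := by rw [← hi]; exact hpr i
  have hj' : p j = r j ^ smax := by rw [← hj]; exact hpr j
  obtain ⟨x₀, hx₀, ε, hε, hball⟩ :=
    hπ.exists_measure_ball_wordMap_le hS hK hp hp1 hU hUne hUb hSU hdisj
  refine typically_lowerDim_eq hK.1
    (hπ.exists_le_measure_ball hS hK hp hp1 hsmax0 fun m => ?_)
    (hπ.exists_measure_ball_le hS hK hp hp1 hU hUne hUb hSU hdisj hsmin0 fun m => ?_)
    (fun x hx η hη => hS.exists_thin_ball hK hp hx₀ hε hball hsmax0 hj' hx hη)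
    (fun x hx η hη => hπ.exists_thick_ball hS hK hp hp1 hsmin0 hi' hx hη)
  · conv_rhs => rw [hpr m]
    exact Real.rpow_le_rpow_of_exponent_ge (hS m).1 (hS m).2.1.le (hsmax.2 (mem_range_self m))
  · conv_lhs => rw [hpr m]
    exact Real.rpow_le_rpow_of_exponent_ge (hS m).1 (hS m).2.1.le (hsmin.2 (mem_range_self m))
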